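/- Let $k$ be a field. For $s\ge 2$ put $n_s(2l)=sl$ and $n_s(2l+1)=sl+1$. Let $S\subseteq\mathbb N_{\ge 2}$ be a finite set. An $\mathbb N_0$-graded $k$-algebra $A$ is called $S$-multi-homogeneous if it is connected ($A_0=k$), $V:=A_1$ is finite dimensional, the canonical morphism $T(V)\to A$ is surjective, and its kernel is the two-sided ideal generated by subspaces $R_s\subseteq V^{\otimes s}$ ($s\in S$) satisfying the minimality condition $$R_s\cap\sum_{t\in S,\,t<s}\ \sum_{j=0}^{s-t}V^{\otimes j}\otimes R_t\otimes V^{\otimes(s-t-j)}=0\qquad(s\in S);$$ then $R=\bigoplus_{s\in S}R_s$ is called a space of relations of $A$. For $i\ge 2$ put $$J_i^s=\bigcap_{j=0}^{n_s(i)-s}V^{\otimes j}\otimes R_s\otimes V^{\otimes(n_s(i)-s-j)},\qquad J_i=\bigoplus_{s\in S}J_i^s .$$ The (left) multi-Koszul complex of $A$ with respect to $R$ is the augmented complex of free left $A$-modules $$\cdots\to A\otimes J_3\xrightarrow{\delta_3}A\otimes J_2\xrightarrow{\delta_2}A\otimes V\xrightarrow{\delta_1}A\to k\to 0,$$ where $\delta_1$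 is the multiplication, the last map is the augmentation, and for $i\ge2$ the map $\delta_i$ is the restriction to $A\otimes J_i^s$, for each $s\in S$, of $\alpha\otimes v_1\cdots v_{n_s(i)}\mapsto \alpha v_1\cdots v_p\otimes v_{p+1}\cdots v_{n_s(i)}$ with $p=s-1$ if $i$ is even and $p=1$ if $i$ is odd. The algebra $A$ is called $S$-multi-Koszul if it is $S$-multi-homogeneous and has a space of relations $R=\bigoplus_{s\in S}R_s$ for which this complex is a resolution of the trivial left $A$-module $k$. It is called $s$-Koszul if it is $\{s\}$-multi-Koszul, i.e. if $A=T(V)/\langle R\rangle$ with $V$ finite dimensional, $R\subseteq V^{\otimes s}$, and its (generalized) Koszul complex is a resolution of $k$. **Proposition.** Let $S\subseteq\mathbb N_{\ge2}$ be a finite set and, for each $s\in S$, let $B^s$ be an $\mathbb N_0$-graded connected $k$-algebra which is $s$-Koszul. Then the free product $A=\coprod_{s\in S}B^s$ (the coproduct in the category of graded algebras, i.e. the free product of algebras, whose degree $n$ part is spanned by the products of homogeneous elements of the factors with degrees adding up to $n$) is $S$-multi-Koszul. -/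

import Mathlib

open scoped TensorProduct DirectSum

namespace MultiKoszul

noncomputable section

universe u v

/-! ### Subspaces of the tensor algebra

Tensor powers are realised inside `TensorAlgebra k V`: the subspace `V^{(n)}` is the `n`-th power
of the degree one part, and `X ⊗ Y ⊆ V^{(a+b)}` is the product `X * Y` of `X ⊆ V^{(a)}` and
`Y ⊆ V^{(b)}`. -/

section Tensor

variable (k : Type u) [Field k] (V : Type v) [AddCommGroup V] [Module k V]

/-- The tensor power `V^{(n)}`, as a subspace of the tensor algebra. -/
def tensorPow (n : ℕ) : Submodule k (TensorAlgebra k V) :=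
  (LinearMap.range (TensorAlgebra.ι k : V →ₗ[k] TensorAlgebra k V)) ^ n

/-- Auxiliary: `v` acts on `T(V) × (V ⊗ T(V))` by `(t, y) ↦ (v t, v ⊗ t)`. -/
def unconsAux : V →ₗ[k] Module.End k (TensorAlgebra k V × (V ⊗[k] TensorAlgebra k V)) :=
  LinearMap.mk₂ k
    (fun v p => ((TensorAlgebra.ι k v * p.1 : TensorAlgebra k V), v ⊗ₜ[k] p.1))
    (fun v w p => by simp [add_mul, TensorProduct.add_tmul])
    (fun c v p => by simp [TensorProduct.smul_tmul'])
    (fun v p q => by simp [mul_add, TensorProduct.tmul_add])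
    (fun c v p => by simp)

theorem unconsAux_apply (v : V) (p : TensorAlgebra k V × (V ⊗[k] TensorAlgebra k V)) :
    unconsAux k V v p = (TensorAlgebra.ι k v * p.1, v ⊗ₜ[k] p.1) := rfl

/-- Splitting off the first letter: `v₁ v₂ ⋯ vₙ ↦ v₁ ⊗ v₂ ⋯ vₙ` for `n ≥ 1`, and `1 ↦ 0`. -/
def uncons : TensorAlgebra k V →ₗ[k] V ⊗[k] TensorAlgebra k V :=
  LinearMap.snd k _ _ ∘ₗ
    LinearMap.applyₗ ((1 : TensorAlgebra k V), (0 : V ⊗[k] TensorAlgebra k V)) ∘ₗ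
      (TensorAlgebra.lift k (unconsAux k V)).toLinearMap

theorem uncons_one : uncons k V 1 = 0 := by
  simp [uncons]

theorem lift_unconsAux_fst (t : TensorAlgebra k V)
    (p : TensorAlgebra k V × (V ⊗[k] TensorAlgebra k V)) :
    (TensorAlgebra.lift k (unconsAux k V) t p).1 = t * p.1 := by
  induction t using TensorAlgebra.induction generalizing p with
  | algebraMap r => simp [Algebra.smul_def]
  | ι x => simp [unconsAux_apply]
  | mul a b ha hb => simp [ha, hb, mul_assoc]
  | add a b ha hb => simp [ha, hb, add_mul]

theorem uncons_ι_mul (v : V) (t : TensorAlgebra k V) :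
    uncons k V (TensorAlgebra.ι k v * t) = v ⊗ₜ[k] t := by
  have h := lift_unconsAux_fst k V t (1, 0)
  simp only [mul_one] at h
  simp [uncons, unconsAux_apply, h]

end Tensor

/-- The `A`-linear map `A ⊗ M → P`, `a ⊗ m ↦ a • f m`, given by a `k`-linear map `f : M → P` into
a left `A`-module `P`. -/
def extendScalars {k : Type*} [Field k] (A : Type*) [Ring A] [Algebra k A] {M P : Type*}
    [AddCommGroup M] [Module k M] [AddCommGroup P] [Module k P] [Module A P] [IsScalarTower k A P]
    (f : M →ₗ[k] P) : A ⊗[k] M →ₗ[A] P :=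
  TensorProduct.AlgebraTensorModule.lift (LinearMap.toSpanSingleton A (M →ₗ[k] P) f)

theorem extendScalars_tmul {k : Type*} [Field k] (A : Type*) [Ring A] [Algebra k A] {M P : Type*}
    [AddCommGroup M] [Module k M] [AddCommGroup P] [Module k P] [Module A P] [IsScalarTower k A P]
    (f : M →ₗ[k] P) (a : A) (m : M) : extendScalars A f (a ⊗ₜ[k] m) = a • f m := rfl

/-- The numbers `n_s(2l) = s l`, `n_s(2l+1) = s l + 1`. -/
def koszulDeg (s i : ℕ) : ℕ := s * (i / 2) + i % 2

/-- For `R ⊆ V^{(s)}` and `i ≥ 2`, the space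
`J_i^s = ⋂_{j=0}^{n_s(i)-s} V^{(j)} ⊗ R ⊗ V^{(n_s(i)-s-j)}`. (Not used for `i < 2`.) -/
def koszulJ (k : Type u) [Field k] (V : Type v) [AddCommGroup V] [Module k V] (s : ℕ)
    (R : Submodule k (TensorAlgebra k V)) (i : ℕ) : Submodule k (TensorAlgebra k V) :=
  ⨅ j ∈ Finset.range (koszulDeg s i - s + 1),
    tensorPow k V j * R * tensorPow k V (koszulDeg s i - s - j)

/-! ### Multi-homogeneous algebras and their left multi-Koszul complex -/

section Graded

variable {k : Type u} [Field k] {A : Type v} [Ring A] [Algebra k A]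
  (𝒜 : ℕ → Submodule k A)

/-- The graded algebra `A` is connected: `A₀ = k · 1`, with `1 ≠ 0`. -/
def IsConnected : Prop := 𝒜 0 = 1 ∧ Nontrivial A

/-- The canonical algebra morphism `T(A₁) → A`. -/
def presentation : TensorAlgebra k (𝒜 1) →ₐ[k] A := TensorAlgebra.lift k (𝒜 1).subtype

/-- With `V = A₁`, the family `R_s ⊆ V^{(s)}` (`s ∈ S`) is a space of relations of `A`: the
two-sided ideal generated by the `R_s` is the kernel of `T(V) → A`, and the `R_s` satisfy the
minimality condition. -/
structure IsRelationSpace (S : Finset ℕ) (R : S → Submodule k (TensorAlgebra k (𝒜 1))) :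
    Prop where
  le_pow : ∀ s : S, R s ≤ tensorPow k (𝒜 1) s
  ker_eq : LinearMap.ker (presentation 𝒜).toLinearMap = ⨆ s : S, ⊤ * R s * ⊤
  minimal : ∀ s : S, R s ⊓ (⨆ t : S, ⨆ (_ : (t : ℕ) < s),
      ⨆ j ∈ Finset.range ((s : ℕ) - t + 1),
        tensorPow k (𝒜 1) j * R t * tensorPow k (𝒜 1) ((s : ℕ) - t - j)) = ⊥

/-- The `A`-linear map `A ⊗ T(V) → A ⊗ T(V)`, `a ⊗ v₁ v₂ ⋯ vₙ ↦ a v₁ ⊗ v₂ ⋯ vₙ` (and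
`a ⊗ 1 ↦ 0`), where `V = A₁`. Its `p`-th power is
`a ⊗ v₁ ⋯ vₙ ↦ a v₁ ⋯ v_p ⊗ v_{p+1} ⋯ vₙ` for `n ≥ p`. -/
def shift : A ⊗[k] TensorAlgebra k (𝒜 1) →ₗ[A] A ⊗[k] TensorAlgebra k (𝒜 1) :=
  extendScalars A
    (TensorProduct.map (𝒜 1).subtype LinearMap.id ∘ₗ uncons k (𝒜 1))

theorem shift_tmul_ι_mul (a : A) (v : 𝒜 1) (t : TensorAlgebra k (𝒜 1)) :
    shift 𝒜 (a ⊗ₜ[k] (TensorAlgebra.ι k v * t)) = (a * (v : A)) ⊗ₜ[k] t := by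
  simp [shift, extendScalars_tmul, uncons_ι_mul, TensorProduct.smul_tmul']

theorem shift_tmul_one (a : A) : shift 𝒜 (a ⊗ₜ[k] 1) = 0 := by
  simp [shift, extendScalars_tmul, uncons_one]

/-- The `A`-linear map `A ⊗ T(V) → A`, `a ⊗ v₁ ⋯ vₙ ↦ a v₁ ⋯ vₙ`; its restriction to `A ⊗ V` is
the differential `δ₁`. -/
def delta1 : A ⊗[k] TensorAlgebra k (𝒜 1) →ₗ[A] A :=
  extendScalars A (presentation 𝒜).toLinearMap

/-- The degree one term `A ⊗ V` of the left multi-Koszul complex, inside `A ⊗ T(V)`. -/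
def complexOne : Submodule A (A ⊗[k] TensorAlgebra k (𝒜 1)) :=
  (tensorPow k (𝒜 1) 1).baseChange A

variable {S : Finset ℕ}

/-- For `i ≥ 2`, the term `A ⊗ J_i = ⨁_{s ∈ S} A ⊗ J_i^s` of the left multi-Koszul complex, inside
`⨁_{s ∈ S} A ⊗ T(V)`. -/
def complexTerm (R : S → Submodule k (TensorAlgebra k (𝒜 1))) (i : ℕ) :
    Submodule A (S → A ⊗[k] TensorAlgebra k (𝒜 1)) :=
  Submodule.pi Set.univ fun s : S => (koszulJ k (𝒜 1) s (R s) i).baseChange A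

/-- The number of letters which the differential `δ_i` moves to the left on the component indexed
by `s`: it is `s - 1` for `i` even and `1` for `i` odd. -/
def jump (s i : ℕ) : ℕ := if Even i then s - 1 else 1

/-- The differential `δ₂`, which is the sum over `s` of the maps
`a ⊗ v₁ ⋯ v_s ↦ a v₁ ⋯ v_{s-1} ⊗ v_s`. -/
def delta2 : (S → A ⊗[k] TensorAlgebra k (𝒜 1)) →ₗ[A] A ⊗[k] TensorAlgebra k (𝒜 1) :=
  ∑ s : S, (shift 𝒜 ^ jump s 2) ∘ₗ LinearMap.proj s

/-- The differential `δ_i` for `i ≥ 3`, given on the component indexed by `s` by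
`a ⊗ v₁ ⋯ vₙ ↦ a v₁ ⋯ v_p ⊗ v_{p+1} ⋯ vₙ`, where `p = s - 1` for `i` even, `p = 1` for `i` odd. -/
def delta (i : ℕ) :
    (S → A ⊗[k] TensorAlgebra k (𝒜 1)) →ₗ[A] (S → A ⊗[k] TensorAlgebra k (𝒜 1)) :=
  LinearMap.pi fun s : S => (shift 𝒜 ^ jump s i) ∘ₗ LinearMap.proj s

/-- The augmented left multi-Koszul complex
`⋯ → A ⊗ J₃ → A ⊗ J₂ → A ⊗ V → A → k → 0` of `A` (whose terms are free left `A`-modules) is a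
resolution of the trivial module `k = A₀`. At each term it is said that the image of the incoming
differential is the kernel of the outgoing one. -/
structure IsResolution [GradedAlgebra 𝒜] (R : S → Submodule k (TensorAlgebra k (𝒜 1))) :
    Prop where
  exact_zero : (complexOne 𝒜).map (delta1 𝒜) = RingHom.ker (GradedRing.projZeroRingHom 𝒜)
  exact_one : (complexTerm 𝒜 R 2).map (delta2 𝒜) =
    complexOne 𝒜 ⊓ LinearMap.ker (delta1 𝒜)
  exact_two : (complexTerm 𝒜 R 3).map (delta 𝒜 3) =
    complexTerm 𝒜 R 2 ⊓ LinearMap.ker (delta2 𝒜 (S := S))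
  exact_ge_three : ∀ i, 3 ≤ i → (complexTerm 𝒜 R (i + 1)).map (delta 𝒜 (i + 1)) =
    complexTerm 𝒜 R i ⊓ LinearMap.ker (delta 𝒜 i)

/-- The graded algebra `A` is (left) `S`-multi-Koszul: it is a connected graded algebra, finitely
generated in degree one, with a space of relations `R = ⨁_{s ∈ S} R_s` whose left multi-Koszul
complex is a resolution of the trivial module. -/
structure IsMultiKoszul (S : Finset ℕ) (𝒜 : ℕ → Submodule k A) [GradedAlgebra 𝒜] : Prop where
  two_le : ∀ s ∈ S, 2 ≤ s
  connected : IsConnected 𝒜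
  finite : Module.Finite k (𝒜 1)
  surjective : Function.Surjective (presentation 𝒜)
  exists_resolution : ∃ R : S → Submodule k (TensorAlgebra k (𝒜 1)),
    IsRelationSpace 𝒜 S R ∧ IsResolution 𝒜 R

/-- The graded algebra `A` is `s`-Koszul (generalized Koszul with relations in degree `s`): it is
`A = T(V)/⟨R⟩` with `R ⊆ V^{(s)}`, and its (generalized) Koszul complex
`⋯ → A ⊗ J₃^s → A ⊗ R → A ⊗ V → A` is a resolution of the trivial module. -/
def IsKoszul (s : ℕ) (𝒜 : ℕ → Submodule k A) [GradedAlgebra 𝒜] : Prop :=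
  IsMultiKoszul {s} 𝒜

end Graded

/-! ### The coproduct of graded algebras -/

section FreeProduct

open LinearAlgebra

variable {k : Type u} [Field k] {I : Type} [DecidableEq I]
  {B : I → Type v} [∀ i, Ring (B i)] [∀ i, Algebra k (B i)]

/-- The grading of the free product of graded algebras: the degree `n` part is spanned by the
products of homogeneous elements of the factors whose degrees add up to `n`. -/
def freeProductGrading (ℬ : ∀ i, ℕ → Submodule k (B i)) (n : ℕ) :
    Submodule k (FreeProduct k B) :=
  Submodule.span k {x | ∃ l : List (Σ i, Σ m, ℬ i m),
    (l.map fun p => p.2.1).sum = n ∧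
      x = (l.map fun p => FreeProduct.ι k B p.1 (p.2.2 : B p.1)).prod}

variable (ℬ : ∀ i, ℕ → Submodule k (B i))

theorem ι_mem_freeProductGrading (i : I) (m : ℕ) (b : ℬ i m) :
    FreeProduct.ι k B i (b : B i) ∈ freeProductGrading ℬ m :=
  Submodule.subset_span ⟨[⟨i, m, b⟩], by simp, by simp⟩

instance freeProductGradedMonoid : SetLike.GradedMonoid (freeProductGrading ℬ) where
  one_mem := Submodule.subset_span ⟨[], by simp, by simp⟩
  mul_mem := by
    intro m n x y hx hy
    have h := Submodule.mul_mem_mul hx hy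
    rw [freeProductGrading, freeProductGrading, Submodule.span_mul_span] at h
    refine Submodule.span_mono ?_ h
    rintro _ ⟨a, ⟨l, hl, rfl⟩, b, ⟨l', hl', rfl⟩, rfl⟩
    exact ⟨l ++ l', by simp [hl, hl'], by simp⟩

variable [∀ i, GradedAlgebra (ℬ i)]

/-- The degree-preserving inclusion of the `i`-th factor, on homogeneous components. -/
def inclComponent (i : I) (m : ℕ) : ℬ i m →ₗ[k] freeProductGrading ℬ m :=
  ((FreeProduct.ι k B i).toLinearMap ∘ₗ (ℬ i m).subtype).codRestrict _
    fun b => ι_mem_freeProductGrading ℬ i m b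

/-- The inclusion of the `i`-th factor, with values in the sum of the homogeneous components. -/
def inclDecompose (i : I) : B i →ₐ[k] ⨁ n, freeProductGrading ℬ n :=
  (DirectSum.toAlgebra k (fun m => ℬ i m)
    (fun m => DirectSum.lof k ℕ (fun n => freeProductGrading ℬ n) m ∘ₗ inclComponent ℬ i m)
    (by
      refine DirectSum.of_eq_of_gradedMonoid_eq (Sigma.subtype_ext rfl ?_)
      exact map_one (FreeProduct.ι k B i))
    (by
      intro m n a b
      simp only [LinearMap.comp_apply, DirectSum.lof_eq_of, DirectSum.of_mul_of]
      refine DirectSum.of_eq_of_gradedMonoid_eq (Sigma.subtype_ext rfl ?_)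
      exact map_mul (FreeProduct.ι k B i) _ _)).comp
    (DirectSum.decomposeAlgEquiv (ℬ i)).toAlgHom

theorem inclDecompose_coe (i : I) (m : ℕ) (b : ℬ i m) :
    inclDecompose ℬ i (b : B i) =
      DirectSum.of (fun n => freeProductGrading ℬ n) m
        ⟨FreeProduct.ι k B i (b : B i), ι_mem_freeProductGrading ℬ i m b⟩ := by
  have h : inclDecompose ℬ i (b : B i) =
      DirectSum.toModule k ℕ _ (fun m => DirectSum.lof k ℕ (fun n => freeProductGrading ℬ n) m ∘ₗ
        inclComponent ℬ i m) (DirectSum.decompose (ℬ i) (b : B i)) := rfl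
  rw [h, DirectSum.decompose_coe, ← DirectSum.lof_eq_of k, DirectSum.toModule_lof]
  rfl

/-- The decomposition of an element of the free product into homogeneous components. -/
def freeProductDecompose : FreeProduct k B →ₐ[k] ⨁ n, freeProductGrading ℬ n :=
  FreeProduct.lift k B (fun {i} => inclDecompose ℬ i)

theorem freeProductDecompose_ι (i : I) (b : B i) :
    freeProductDecompose ℬ (FreeProduct.ι k B i b) = inclDecompose ℬ i b :=
  AlgHom.congr_fun (FreeProduct.lift_comp_ι k B (fun {i} => inclDecompose ℬ i) (i := i)) b

theorem freeProductDecompose_prod (l : List (Σ i, Σ m, ℬ i m))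
    (h : (l.map fun p => FreeProduct.ι k B p.1 (p.2.2 : B p.1)).prod ∈
      freeProductGrading ℬ (l.map fun p => p.2.1).sum) :
    freeProductDecompose ℬ (l.map fun p => FreeProduct.ι k B p.1 (p.2.2 : B p.1)).prod =
      DirectSum.of (fun n => freeProductGrading ℬ n) (l.map fun p => p.2.1).sum ⟨_, h⟩ := by
  induction l with
  | nil => exact map_one _
  | cons p l ih =>
    have h' : (l.map fun p => FreeProduct.ι k B p.1 (p.2.2 : B p.1)).prod ∈
        freeProductGrading ℬ (l.map fun p => p.2.1).sum :=
      Submodule.subset_span ⟨l, rfl, rfl⟩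
    simp only [List.map_cons, List.prod_cons, map_mul, ih h', freeProductDecompose_ι,
      inclDecompose_coe, DirectSum.of_mul_of]
    exact DirectSum.of_eq_of_gradedMonoid_eq (Sigma.subtype_ext rfl rfl)

theorem freeProductDecompose_coe (n : ℕ) (x : freeProductGrading ℬ n) :
    freeProductDecompose ℬ (x : FreeProduct k B) =
      DirectSum.of (fun n => freeProductGrading ℬ n) n x := by
  obtain ⟨x, hx⟩ := x
  simp only
  induction hx using Submodule.span_induction with
  | mem x h =>
    obtain ⟨l, rfl, rfl⟩ := h
    exact freeProductDecompose_prod ℬ l _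
  | zero => exact (map_zero _).trans (map_zero _).symm
  | add x y hx hy ihx ihy =>
    rw [map_add, ihx, ihy, ← map_add]
    rfl
  | smul c x hx ih =>
    rw [map_smul, ih, ← DirectSum.lof_eq_of k, ← map_smul]
    rfl

theorem coe_inclDecompose (i : I) (b : B i) :
    DirectSum.coeAlgHom (freeProductGrading ℬ) (inclDecompose ℬ i b) =
      FreeProduct.ι k B i b := by
  induction b using DirectSum.Decomposition.inductionOn (ℬ i) with
  | zero => simp
  | homogeneous b => rw [inclDecompose_coe, DirectSum.coeAlgHom_of]
  | add a b ha hb => simp only [map_add, ha, hb]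

theorem coe_freeProductDecompose :
    (DirectSum.coeAlgHom (freeProductGrading ℬ)).comp (freeProductDecompose ℬ) =
      AlgHom.id k (FreeProduct k B) := by
  refine (FreeProduct.lift k B).symm.injective ?_
  funext i
  ext b
  change DirectSum.coeAlgHom (freeProductGrading ℬ)
    (freeProductDecompose ℬ (FreeProduct.ι k B i b)) = FreeProduct.ι k B i b
  rw [freeProductDecompose_ι, coe_inclDecompose]

/-- The free product of graded algebras, with the grading above, is a graded algebra. -/
instance freeProductGradedAlgebra : GradedAlgebra (freeProductGrading ℬ) :=
  GradedAlgebra.ofAlgHom _ (freeProductDecompose ℬ) (coe_freeProductDecompose ℬ)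
    (freeProductDecompose_coe ℬ)

end FreeProduct

end

end MultiKoszul

/-! Write `V_s` for the degree one part of `B^s`. The degree one part of `A` is `V = ⨁ V_s`, and the
relations `R_s` of the factors, transported to `T(V)`, present `A`.

The point is that, apart from its last two terms, the multi-Koszul complex of `A` is a direct sum
over `s` of complexes induced from those of the factors. Three facts give this and the exactness.

Freeness: `A` is a free right `B^s`-module on the reduced words not ending in a letter of `B^s`, so
inducing from `B^s` to `A` preserves exactness (`freeProductCombination_bijective`,
`FreeExtension.exact_shift`). The normal form comes from van der Waerden's trick: the free product
acts from the right on the span of reduced words (`wordEval_bijective`).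

Locality of `J_i`: in `J_i^s` every letter is covered by some copy of `R_s`, so it lies in `V_s`.
Hence `J_i^s` is the same whether computed in `T(V_s)` or in `T(V)` (`koszulJ_map`).

Independence: the factors meet only in `A ⊗ V` and `A`. Since `A ⊗ V` is the direct sum of the `A ⊗
V_s`, the kernel of `δ₂` splits over `s` (`eq_zero_of_sum_eq_zero`). Since the left ideals generated
in `A` by the augmentation ideals of the `B^s` are independent, being spanned by the words ending in
`B^s`, so does the kernel of `δ₁` (`freeProductCombination_independent`). At `A` itself, exactness
is generation in degree one. -/

namespace MultiKoszul

noncomputable section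

universe u v

/-! ### Reduced words in a free product of augmented algebras -/

section FreeProductWords

open LinearAlgebra

variable {k : Type u} [Field k] {I : Type}
  {B : I → Type v} [∀ i, Ring (B i)] [∀ i, Algebra k (B i)]

/-- The splitting of an augmented algebra into the scalars and the augmentation ideal. -/
def augmentationSplit {C : Type*} [Ring C] [Algebra k C] (ε : C →ₐ[k] k) :
    C ≃ₗ[k] k × LinearMap.ker ε.toLinearMap where
  toFun c := (ε c, ⟨c - algebraMap k C (ε c), by simp⟩)
  map_add' a b := by
    refine Prod.ext (by simp) (Subtype.ext ?_)
    simp; abel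
  map_smul' r a := by
    refine Prod.ext (by simp) (Subtype.ext ?_)
    simp [Algebra.algebraMap_eq_smul_one, smul_sub, mul_smul]
  invFun p := algebraMap k C p.1 + p.2
  left_inv c := by simp
  right_inv p := by
    have h : ε (p.2 : C) = 0 := p.2.2
    refine Prod.ext (by simp [h]) (Subtype.ext ?_)
    simp [h]

variable (ε : ∀ i, B i →ₐ[k] k)

/-- The index set of a basis of the augmentation ideal. -/
abbrev Letter (i : I) : Type v :=
  Module.Basis.ofVectorSpaceIndex k (LinearMap.ker (ε i).toLinearMap)

/-- A basis consisting of `1` and of a basis of the augmentation ideal. -/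
def augBasis (i : I) : Module.Basis (Unit ⊕ Letter ε i) k (B i) :=
  ((Module.Basis.singleton Unit k).prod (Module.Basis.ofVectorSpace k _)).map
    (augmentationSplit (ε i)).symm

theorem augBasis_inl (i : I) : augBasis ε i (Sum.inl ()) = 1 := by
  simp [augBasis, augmentationSplit]

theorem augBasis_inr (i : I) (x : Letter ε i) :
    augBasis ε i (Sum.inr x) = (x : LinearMap.ker (ε i).toLinearMap) := by
  simp [augBasis, augmentationSplit]

theorem augBasis_repr_inl (i : I) (b : B i) :
    (augBasis ε i).repr b (Sum.inl ()) = ε i b := by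
  simp [augBasis, augmentationSplit]

/-- Reduced words; the head of the list is the last letter of the word. -/
def RedWord : Type v :=
  {l : List (Σ i, Letter ε i) // l.IsChain fun a b => a.1 ≠ b.1}

/-- The empty word. -/
def emptyWord : RedWord ε := ⟨[], .nil⟩

/-- Reduced words whose last letter is not in the `i`-th factor. -/
def RedWordAvoiding (i : I) : Type v :=
  {w : RedWord ε // ∀ a ∈ w.1.head?, a.1 ≠ i}

variable {ε} in
/-- A reduced word not ending in the `i`-th factor, extended by `1` or a letter. -/
def RedWordAvoiding.extend {i : I} (w : RedWordAvoiding ε i) : Unit ⊕ Letter ε i → RedWord ε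
  | Sum.inl _ => w.1
  | Sum.inr x => ⟨⟨i, x⟩ :: w.1.1, by
      refine List.isChain_cons.2 ⟨fun a ha => (w.2 a ha).symm, w.1.2⟩⟩

/-- Strip the last letter of a word if it lies in the `i`-th factor. The rest cannot end in that
factor, because the word is reduced. -/
theorem extend_bijective (i : I) :
    Function.Bijective fun p : RedWordAvoiding ε i × (Unit ⊕ Letter ε i) => p.1.extend p.2 := by
  constructor
  · rintro ⟨⟨⟨l, hl⟩, h⟩, (_ | x)⟩ ⟨⟨⟨l', hl'⟩, h'⟩, (_ | x')⟩ e <;>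
      have e := congrArg Subtype.val e <;>
      simp only [RedWordAvoiding.extend] at e
    · subst e; rfl
    · subst e; exact absurd rfl (h ⟨i, x'⟩ (by simp))
    · subst e; exact absurd rfl (h' ⟨i, x⟩ (by simp))
    · simp only [List.cons.injEq, Sigma.mk.injEq, heq_eq_eq, true_and] at e
      obtain ⟨rfl, rfl⟩ := e; rfl
  · rintro ⟨l, hl⟩
    match l, hl with
    | [], hl => exact ⟨(⟨⟨[], hl⟩, by simp⟩, Sum.inl ()), rfl⟩
    | ⟨j, x⟩ :: l, hl =>
      by_cases hj : j = i
      · subst hj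
        have := List.isChain_cons.1 hl
        exact ⟨(⟨⟨l, this.2⟩, fun a ha => (this.1 a ha).symm⟩, Sum.inr x), rfl⟩
      · exact ⟨(⟨⟨⟨j, x⟩ :: l, hl⟩, by simpa using hj⟩, Sum.inl ()), rfl⟩

/-- The free module on reduced words is a free right module over each factor. -/
def wordEquiv (i : I) : (RedWordAvoiding ε i →₀ B i) ≃ₗ[k] (RedWord ε →₀ k) :=
  -- Expand each coefficient in the basis formed by `1` and the letters; a pair (word, basis
  -- element) is then again a reduced word.
  (Finsupp.mapRange.linearEquiv (augBasis ε i).repr).trans <|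
    (Finsupp.curryLinearEquiv k).symm.trans <|
      Finsupp.domLCongr (Equiv.ofBijective _ (extend_bijective ε i))

theorem wordEquiv_apply (i : I) (f : RedWordAvoiding ε i →₀ B i) (w : RedWordAvoiding ε i)
    (t : Unit ⊕ Letter ε i) :
    wordEquiv ε i f (w.extend t) = (augBasis ε i).repr (f w) t := by
  have h : (Equiv.ofBijective _ (extend_bijective ε i)).symm (w.extend t) = (w, t) :=
    (Equiv.ofBijective _ (extend_bijective ε i)).symm_apply_apply (w, t)
  simp only [wordEquiv, LinearEquiv.trans_apply, Finsupp.domLCongr_apply,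
    Finsupp.domCongr_apply, Finsupp.equivMapDomain_apply, h]
  rfl

theorem wordEquiv_single_basis (i : I) (w : RedWordAvoiding ε i) (t : Unit ⊕ Letter ε i) :
    wordEquiv ε i (Finsupp.single w (augBasis ε i t)) = Finsupp.single (w.extend t) 1 := by
  simp [wordEquiv]

/-- Right multiplication by an element of the `i`-th factor on words. -/
def wordAct (i : I) : B i →ₐ[k] (Module.End k (RedWord ε →₀ k))ᵐᵒᵖ :=
  AlgHom.ofLinearMap
    -- Coefficients are multiplied by `b` on the right. Such operators compose in reverse order,
    -- hence the opposite algebra.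
    { toFun := fun b => MulOpposite.op ((wordEquiv ε i).toLinearMap ∘ₗ
        Finsupp.mapRange.linearMap (LinearMap.mulRight k b) ∘ₗ (wordEquiv ε i).symm.toLinearMap)
      map_add' := fun a b => by
        rw [← MulOpposite.op_add]
        congr 1
        ext w : 1
        refine LinearMap.ext fun c => ?_
        simp only [LinearMap.comp_apply, LinearEquiv.coe_coe, LinearMap.add_apply, ← map_add]
        congr 1
        ext w
        simp [mul_add]
      map_smul' := fun c b => by
        rw [RingHom.id_apply, ← MulOpposite.op_smul]
        congr 1
        ext w : 1
        refine LinearMap.ext fun r => ?_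
        simp only [LinearMap.comp_apply, LinearEquiv.coe_coe, LinearMap.smul_apply]
        rw [← map_smul]
        congr 1
        ext w
        simp }
    (by
      refine MulOpposite.unop_injective ?_
      refine LinearMap.ext fun x => ?_
      change wordEquiv ε i (Finsupp.mapRange.linearMap (LinearMap.mulRight k 1)
        ((wordEquiv ε i).symm x)) = x
      rw [LinearEquiv.eq_symm_apply .. |>.symm]
      ext w
      simp)
    (fun a b => by
      refine MulOpposite.unop_injective ?_
      refine LinearMap.ext fun x => ?_
      change wordEquiv ε i (Finsupp.mapRange.linearMap (LinearMap.mulRight k (a * b))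
        ((wordEquiv ε i).symm x)) = wordEquiv ε i (Finsupp.mapRange.linearMap
          (LinearMap.mulRight k b) ((wordEquiv ε i).symm (wordEquiv ε i
            (Finsupp.mapRange.linearMap (LinearMap.mulRight k a) ((wordEquiv ε i).symm x)))))
      rw [LinearEquiv.symm_apply_apply]
      congr 1
      ext w
      simp [mul_assoc])

theorem wordAct_wordEquiv (i : I) (b : B i) (f : RedWordAvoiding ε i →₀ B i) :
    (wordAct ε i b).unop (wordEquiv ε i f) =
      wordEquiv ε i (Finsupp.mapRange.linearMap (LinearMap.mulRight k b) f) := by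
  change wordEquiv ε i (Finsupp.mapRange.linearMap (LinearMap.mulRight k b)
    ((wordEquiv ε i).symm (wordEquiv ε i f))) = _
  rw [LinearEquiv.symm_apply_apply]

theorem wordAct_single (i : I) (w : RedWordAvoiding ε i) (x : Letter ε i) :
    (wordAct ε i (x : LinearMap.ker (ε i).toLinearMap)).unop (Finsupp.single w.1 1) =
      Finsupp.single (w.extend (Sum.inr x)) 1 := by
  have h := wordEquiv_single_basis ε i w (Sum.inl ())
  rw [augBasis_inl] at h
  change _ = Finsupp.single w.1 1 at h
  rw [← h, wordAct_wordEquiv, ← wordEquiv_single_basis, augBasis_inr]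
  simp

variable [DecidableEq I]

/-- The elements satisfying `p` form a subalgebra. By the universal property the identity factors
through it, so it is everything. -/
theorem freeProduct_induction {p : FreeProduct k B → Prop}
    (algebraMap : ∀ c : k, p (algebraMap k _ c))
    (ι : ∀ i b, p (FreeProduct.ι k B i b))
    (add : ∀ x y, p x → p y → p (x + y)) (mul : ∀ x y, p x → p y → p (x * y))
    (x : FreeProduct k B) : p x := by
  let P : Subalgebra k (FreeProduct k B) :=
    { carrier := {x | p x}
      mul_mem' := fun {a b} ha hb => mul a b ha hb
      add_mem' := fun {a b} ha hb => add a b ha hb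
      algebraMap_mem' := algebraMap }
  let f : FreeProduct k B →ₐ[k] P :=
    FreeProduct.lift k B fun {i} => (FreeProduct.ι k B i).codRestrict P (ι i)
  have h : P.val.comp f = AlgHom.id k _ := by
    refine (FreeProduct.lift k B).symm.injective ?_
    funext i
    ext b
    have := AlgHom.congr_fun (FreeProduct.lift_comp_ι k B
      (fun {i} => (FreeProduct.ι k B i).codRestrict P (ι i)) (i := i)) b
    exact congrArg Subtype.val this
  have hx := AlgHom.congr_fun h x
  rw [← show _ = x from hx]
  exact (f x).2

theorem freeProduct_lift_ι {C : Type*} [Semiring C] [Algebra k C]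
    (f : ∀ i, B i →ₐ[k] C) (i : I) (b : B i) :
    FreeProduct.lift k B (fun {i} => f i) (FreeProduct.ι k B i b) = f i b :=
  AlgHom.congr_fun (FreeProduct.lift_comp_ι k B (fun {i} => f i) (i := i)) b

/-- The identity of `B i` if `j = i`, and otherwise the augmentation of `B j`, with values in
`B i`. -/
def factorHom (i j : I) : B j →ₐ[k] B i :=
  if h : j = i then h ▸ AlgHom.id k (B j) else (Algebra.ofId k (B i)).comp (ε j)

theorem factorHom_self (i : I) : factorHom ε i i = AlgHom.id k (B i) := by
  simp [factorHom]

theorem factorHom_of_ne {i j : I} (h : j ≠ i) (b : B j) :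
    factorHom ε i j b = algebraMap k (B i) (ε j b) := by
  simp [factorHom, h, Algebra.ofId_apply]

/-- The projection of a free product of augmented algebras on one of the factors. -/
def freeProductProj (i : I) : FreeProduct k B →ₐ[k] B i :=
  FreeProduct.lift k B fun {j} => factorHom ε i j

theorem freeProductProj_ι_self (i : I) (b : B i) :
    freeProductProj ε i (FreeProduct.ι k B i b) = b := by
  refine (freeProduct_lift_ι (factorHom ε i) i b).trans ?_
  rw [factorHom_self, AlgHom.id_apply]

theorem freeProductProj_ι_of_ne {i j : I} (h : j ≠ i) (b : B j) :
    freeProductProj ε i (FreeProduct.ι k B j b) = algebraMap k (B i) (ε j b) :=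
  (freeProduct_lift_ι (factorHom ε i) j b).trans (factorHom_of_ne ε h b)


/-- The value of a word in the free product. -/
def wordValue (l : List (Σ i, Letter ε i)) : FreeProduct k B :=
  l.foldr (fun a x => x * FreeProduct.ι k B a.1 (a.2 : LinearMap.ker (ε a.1).toLinearMap)) 1

theorem wordValue_nil : wordValue ε [] = 1 := rfl

theorem wordValue_cons (a : Σ i, Letter ε i) (l : List (Σ i, Letter ε i)) :
    wordValue ε (a :: l) = wordValue ε l *
      FreeProduct.ι k B a.1 (a.2 : LinearMap.ker (ε a.1).toLinearMap) := rfl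

/-- The linear map sending words to their values. -/
def wordEval : (RedWord ε →₀ k) →ₗ[k] FreeProduct k B :=
  Finsupp.linearCombination k fun w => wordValue ε w.1

theorem wordEval_single (w : RedWord ε) (c : k) :
    wordEval ε (Finsupp.single w c) = c • wordValue ε w.1 :=
  Finsupp.linearCombination_single k c w

/-- The map `f ↦ ∑ w, w * f w`, for `w` running through the words not ending in the `i`-th
factor. -/
def freeProductCombination (i : I) : (RedWordAvoiding ε i →₀ B i) →ₗ[k] FreeProduct k B :=
  Finsupp.lsum k fun w => LinearMap.mulLeft k (wordValue ε w.1.1) ∘ₗ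
    (FreeProduct.ι k B i).toLinearMap

theorem freeProductCombination_single (i : I) (w : RedWordAvoiding ε i) (b : B i) :
    freeProductCombination ε i (Finsupp.single w b) =
      wordValue ε w.1.1 * FreeProduct.ι k B i b := by
  simp [freeProductCombination]

theorem freeProductCombination_mulRight (i : I) (f : RedWordAvoiding ε i →₀ B i) (b : B i) :
    freeProductCombination ε i (Finsupp.mapRange.linearMap (LinearMap.mulRight k b) f) =
      freeProductCombination ε i f * FreeProduct.ι k B i b := by
  induction f using Finsupp.induction_linear with
  | zero => simp
  | add f g hf hg => rw [map_add, map_add, map_add, hf, hg, add_mul]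
  | single w c =>
    rw [Finsupp.mapRange.linearMap_apply, Finsupp.mapRange_single,
      freeProductCombination_single, freeProductCombination_single, LinearMap.mulRight_apply,
      map_mul, mul_assoc]

/-- Suffices on `augBasis`: the element `1` leaves the word alone, and a letter is appended at its
end. -/
theorem wordEval_wordEquiv (i : I) (f : RedWordAvoiding ε i →₀ B i) :
    wordEval ε (wordEquiv ε i f) = freeProductCombination ε i f := by
  induction f using Finsupp.induction_linear with
  | zero => simp
  | add f g hf hg => rw [map_add, map_add, map_add, hf, hg]
  | single w c =>
    have : (wordEval ε ∘ₗ (wordEquiv ε i).toLinearMap) ∘ₗ Finsupp.lsingle w =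
        freeProductCombination ε i ∘ₗ Finsupp.lsingle w := by
      refine (augBasis ε i).ext fun t => ?_
      simp only [LinearMap.comp_apply, LinearEquiv.coe_coe, Finsupp.lsingle_apply,
        wordEquiv_single_basis, freeProductCombination_single, wordEval,
        Finsupp.linearCombination_single, one_smul]
      obtain (_ | x) := t
      · rw [augBasis_inl, map_one, mul_one]; rfl
      · rw [augBasis_inr]; rfl
    exact LinearMap.congr_fun this c

/-- The right action of the free product on words. -/
def freeProductAct : FreeProduct k B →ₐ[k] (Module.End k (RedWord ε →₀ k))ᵐᵒᵖ :=
  FreeProduct.lift k B fun {i} => wordAct ε i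

theorem freeProductAct_ι (i : I) (b : B i) :
    freeProductAct ε (FreeProduct.ι k B i b) = wordAct ε i b :=
  freeProduct_lift_ι (wordAct ε) i b

/-- Evaluation is a morphism of right modules. For `a` in one factor, both sides are right
multiplication of coefficients in the free module over that factor. -/
theorem wordEval_act (a : FreeProduct k B) (x : RedWord ε →₀ k) :
    wordEval ε ((freeProductAct ε a).unop x) = wordEval ε x * a := by
  induction a using freeProduct_induction generalizing x with
  | algebraMap c =>
    rw [AlgHom.commutes, MulOpposite.algebraMap_apply, MulOpposite.unop_op,
      Module.algebraMap_end_apply, map_smul, Algebra.algebraMap_eq_smul_one, mul_smul_comm, mul_one]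
  | ι i b =>
    obtain ⟨f, rfl⟩ := (wordEquiv ε i).surjective x
    rw [freeProductAct_ι, wordAct_wordEquiv, wordEval_wordEquiv, wordEval_wordEquiv,
      freeProductCombination_mulRight]
  | add a b ha hb =>
    rw [map_add, MulOpposite.unop_add, LinearMap.add_apply, map_add, ha, hb, mul_add]
  | mul a b ha hb =>
    rw [map_mul, MulOpposite.unop_mul, Module.End.mul_apply, hb, ha, mul_assoc]

theorem freeProductAct_wordValue (w : RedWord ε) :
    (freeProductAct ε (wordValue ε w.1)).unop (Finsupp.single (emptyWord ε) 1) =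
      Finsupp.single w 1 := by
  obtain ⟨l, hl⟩ := w
  induction l with
  | nil => rw [wordValue_nil, map_one]; rfl
  | cons a l ih =>
    have h := List.isChain_cons.1 hl
    rw [wordValue_cons, map_mul, MulOpposite.unop_mul, Module.End.mul_apply, ih h.2,
      freeProductAct_ι]
    exact wordAct_single ε a.1 ⟨⟨l, h.2⟩, fun b hb => (h.1 b hb).symm⟩ a.2

/-- Van der Waerden's argument: the inverse sends `a` to the result of acting by `a` on the empty
word. A reduced word acts by building itself up letter by letter, which gives injectivity;
equivariance of evaluation gives surjectivity. -/
theorem wordEval_bijective : Function.Bijective (wordEval ε) := by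
  constructor
  · refine Function.LeftInverse.injective
      (g := fun a => (freeProductAct ε a).unop (Finsupp.single (emptyWord ε) 1)) fun x => ?_
    induction x using Finsupp.induction_linear with
    | zero => simp
    | add x y hx hy =>
      simp only [map_add, MulOpposite.unop_add, LinearMap.add_apply] at *
      rw [hx, hy]
    | single w c =>
      simp only [wordEval_single, map_smul, MulOpposite.unop_smul,
        LinearMap.smul_apply, freeProductAct_wordValue, Finsupp.smul_single, smul_eq_mul, mul_one]
  · intro a
    refine ⟨(freeProductAct ε a).unop (Finsupp.single (emptyWord ε) 1), ?_⟩
    rw [wordEval_act, wordEval_single, one_smul]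
    exact one_mul a

/-- The free product is free as a right module over each factor. -/
theorem freeProductCombination_bijective (i : I) :
    Function.Bijective (freeProductCombination ε i) := by
  have : ⇑(freeProductCombination ε i) = wordEval ε ∘ wordEquiv ε i :=
    funext fun f => (wordEval_wordEquiv ε i f).symm
  rw [this]
  exact (wordEval_bijective ε).comp (wordEquiv ε i).bijective

/-- The left ideals generated by the augmentation ideals of the factors are independent. -/
theorem freeProductCombination_independent [Fintype I]
    (f : ∀ i, RedWordAvoiding ε i →₀ B i) (hf : ∀ i w, ε i (f i w) = 0)
    (h : ∑ i, freeProductCombination ε i (f i) = 0) (i : I) : f i = 0 := by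
  have h0 : ∑ j, wordEquiv ε j (f j) = 0 := by
    refine (wordEval_bijective ε).1 ?_
    rw [map_sum, map_zero, ← h]
    exact Finset.sum_congr rfl fun j _ => wordEval_wordEquiv ε j (f j)
  -- The coordinate at a word not ending in factor `j` is the coefficient of `1`, that is, the
  -- augmentation. So the `j`-th summand is supported on words ending in factor `j`, and these
  -- supports are disjoint.
  have avoid : ∀ j (w : RedWordAvoiding ε j), wordEquiv ε j (f j) w.1 = 0 := fun j w => by
    have := wordEquiv_apply ε j (f j) w (Sum.inl ())
    rwa [augBasis_repr_inl, hf] at this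
  refine (wordEquiv ε i).injective ?_
  rw [map_zero]
  ext w
  rw [Finsupp.zero_apply]
  by_cases hw : ∀ a ∈ w.1.head?, a.1 ≠ i
  · exact avoid i ⟨w, hw⟩
  · have := DFunLike.congr_fun h0 w
    rw [Finsupp.finsetSum_apply, Finset.sum_eq_single i] at this
    · exact this
    · intro j _ hj
      refine avoid j ⟨w, fun a ha ha' => ?_⟩
      refine hw fun b hb hb' => hj ?_
      rw [← hb', ← ha']
      exact congrArg Sigma.fst (Option.mem_unique ha hb)
    · simp

end FreeProductWords

/-! ### Induction on, and functoriality of, tensor algebras -/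

section TensorInduction

variable {k : Type u} [Field k] {V W : Type*} [AddCommGroup V] [Module k V]
  [AddCommGroup W] [Module k W]

theorem tensorAlgebra_left_induction {p : TensorAlgebra k V → Prop} (one : p 1)
    (ι_mul : ∀ v t, p t → p (TensorAlgebra.ι k v * t))
    (add : ∀ x y, p x → p y → p (x + y)) (smul : ∀ (c : k) x, p x → p (c • x))
    (t : TensorAlgebra k V) : p t := by
  -- With an arbitrary right factor `s`, a product `a * b` is handled by applying `b` first and then
  -- `a`.
  suffices ∀ s, p s → p (t * s) by simpa using this 1 one
  induction t using TensorAlgebra.induction with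
  | algebraMap r => intro s hs; rw [← Algebra.smul_def]; exact smul _ _ hs
  | ι x => exact ι_mul x
  | mul a b ha hb => intro s hs; rw [mul_assoc]; exact ha _ (hb _ hs)
  | add a b ha hb => intro s hs; rw [add_mul]; exact add _ _ (ha _ hs) (hb _ hs)

/-- The morphism of tensor algebras induced by a linear map. -/
def tensorMap (f : V →ₗ[k] W) : TensorAlgebra k V →ₐ[k] TensorAlgebra k W :=
  TensorAlgebra.lift k (TensorAlgebra.ι k ∘ₗ f)

@[simp]
theorem tensorMap_ι (f : V →ₗ[k] W) (v : V) :
    tensorMap f (TensorAlgebra.ι k v) = TensorAlgebra.ι k (f v) := by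
  simp [tensorMap]

theorem tensorPow_map_le (f : V →ₗ[k] W) (n : ℕ) :
    (tensorPow k V n).map (tensorMap f).toLinearMap ≤ tensorPow k W n := by
  rw [tensorPow, tensorPow, Submodule.map_pow]
  refine pow_le_pow_left' ?_ n
  rintro _ ⟨_, ⟨v, rfl⟩, rfl⟩
  exact ⟨f v, by simp⟩

theorem tensorPow_zero : tensorPow k V 0 = 1 := pow_zero _

theorem tensorPow_one :
    tensorPow k V 1 = LinearMap.range (TensorAlgebra.ι k : V →ₗ[k] TensorAlgebra k V) := pow_one _

theorem tensorPow_add (m n : ℕ) : tensorPow k V (m + n) = tensorPow k V m * tensorPow k V n :=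
  pow_add _ _ _

end TensorInduction

/-! ### Extension of the multi-Koszul complex along a free extension of algebras -/

/-- The extension of graded algebras `A / B`, where `A` is a free right module over `B` with basis
`u`, and `B₁` is a direct summand of `A₁`. -/
structure FreeExtension {k : Type u} [Field k] {A B N : Type*} [Ring A] [Algebra k A] [Ring B]
    [Algebra k B] (𝒜 : ℕ → Submodule k A) (ℬ : ℕ → Submodule k B) where
  φ : B →ₐ[k] A
  inc : ℬ 1 →ₗ[k] 𝒜 1
  ρ : 𝒜 1 →ₗ[k] ℬ 1
  coe_inc : ∀ v, (inc v : A) = φ v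
  ρ_inc : ∀ v, ρ (inc v) = v
  u : N → A
  equiv : (N →₀ B) ≃ₗ[k] A
  equiv_single : ∀ n b, equiv (Finsupp.single n b) = u n * φ b

namespace FreeExtension

variable {k : Type u} [Field k] {A B N : Type*} [Ring A] [Algebra k A] [Ring B]
    [Algebra k B] {𝒜 : ℕ → Submodule k A} {ℬ : ℕ → Submodule k B}
    (F : FreeExtension (N := N) 𝒜 ℬ)

/-- The inclusion of tensor algebras. -/
def θ : TensorAlgebra k (ℬ 1) →ₐ[k] TensorAlgebra k (𝒜 1) := tensorMap F.inc

/-- The retraction of tensor algebras. -/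
def ret : TensorAlgebra k (𝒜 1) →ₐ[k] TensorAlgebra k (ℬ 1) := tensorMap F.ρ

theorem θ_ι (v : ℬ 1) : F.θ (TensorAlgebra.ι k v) = TensorAlgebra.ι k (F.inc v) :=
  tensorMap_ι F.inc v

theorem ret_ι (v : 𝒜 1) : F.ret (TensorAlgebra.ι k v) = TensorAlgebra.ι k (F.ρ v) :=
  tensorMap_ι F.ρ v

theorem ret_θ (t : TensorAlgebra k (ℬ 1)) : F.ret (F.θ t) = t := by
  have : F.ret.comp F.θ = AlgHom.id k _ := by
    ext v
    simp [ret, θ, F.ρ_inc]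
  exact AlgHom.congr_fun this t

theorem presentation_θ (t : TensorAlgebra k (ℬ 1)) :
    presentation 𝒜 (F.θ t) = F.φ (presentation ℬ t) := by
  have : (presentation 𝒜).comp F.θ = F.φ.comp (presentation ℬ) := by
    ext v
    simp [presentation, θ, F.coe_inc]
  exact AlgHom.congr_fun this t

/-- The map `f ↦ ∑ n, u n * f n` on tensors. -/
def lam : (N →₀ B ⊗[k] TensorAlgebra k (ℬ 1)) →ₗ[k] A ⊗[k] TensorAlgebra k (𝒜 1) :=
  Finsupp.lsum k fun n =>
    TensorProduct.map (LinearMap.mulLeft k (F.u n) ∘ₗ F.φ.toLinearMap) F.θ.toLinearMap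

theorem lam_single_tmul (n : N) (b : B) (t : TensorAlgebra k (ℬ 1)) :
    F.lam (Finsupp.single n (b ⊗ₜ t)) = (F.u n * F.φ b) ⊗ₜ F.θ t := by
  simp [lam]

/-- A left inverse reads off the coordinates of the `A`-factor in the basis `u` and applies the
retraction `ret` to the tensor factor. -/
theorem lam_injective : Function.Injective F.lam := by
  classical
  refine Function.LeftInverse.injective (g := fun x => TensorProduct.finsuppLeft k k B _ N
    (TensorProduct.map F.equiv.symm.toLinearMap F.ret.toLinearMap x)) fun f => ?_
  induction f using Finsupp.induction_linear with
  | zero => simp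
  | add f g hf hg => simp only [map_add] at *; rw [hf, hg]
  | single n x =>
    induction x using TensorProduct.induction_on with
    | zero => simp
    | add x y hx hy => simp only [Finsupp.single_add, map_add] at *; rw [hx, hy]
    | tmul b t =>
      rw [lam_single_tmul, ← F.equiv_single]
      simp [F.ret_θ, TensorProduct.finsuppLeft_apply_tmul]

/-- A letter moved to the left multiplies the coefficient `u n * φ b` on its right end, so it is
absorbed into `b` and the basis element `u n` is untouched. -/
theorem shift_lam (f : N →₀ B ⊗[k] TensorAlgebra k (ℬ 1)) :
    shift 𝒜 (F.lam f) = F.lam (f.mapRange (shift ℬ) (map_zero _)) := by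
  induction f using Finsupp.induction_linear with
  | zero => simp
  | add f g hf hg =>
    rw [map_add, map_add, hf, hg, ← map_add, Finsupp.mapRange_add (map_add _)]
  | single n x =>
    rw [Finsupp.mapRange_single]
    induction x using TensorProduct.induction_on with
    | zero => simp
    | add x y hx hy => simp only [Finsupp.single_add, map_add] at *; rw [hx, hy]
    | tmul b t =>
      rw [lam_single_tmul]
      induction t using tensorAlgebra_left_induction with
      | one => simp [shift_tmul_one]
      | ι_mul v t _ =>
        rw [map_mul, shift_tmul_ι_mul, lam_single_tmul]
        simp only [θ, tensorMap_ι, shift_tmul_ι_mul, F.coe_inc, map_mul, mul_assoc]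
      | add x y hx hy => simp only [TensorProduct.tmul_add, Finsupp.single_add, map_add, hx, hy]
      | smul c x hx =>
        rw [map_smul, TensorProduct.tmul_smul, TensorProduct.tmul_smul,
          (shift 𝒜).map_smul_of_tower, (shift ℬ).map_smul_of_tower, hx, ← Finsupp.smul_single,
          map_smul]

theorem shift_pow_lam (p : ℕ) (f : N →₀ B ⊗[k] TensorAlgebra k (ℬ 1)) :
    (shift 𝒜 ^ p) (F.lam f) = F.lam (f.mapRange (shift ℬ ^ p : Module.End B _) (map_zero _)) := by
  induction p generalizing f with
  | zero => exact congrArg F.lam (Finsupp.ext fun n => by simp)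
  | succ p ih =>
    rw [pow_succ, Module.End.mul_apply, shift_lam, ih]
    congr 1
    ext n
    simp [pow_succ]

theorem delta1_lam (f : N →₀ B ⊗[k] TensorAlgebra k (ℬ 1)) :
    delta1 𝒜 (F.lam f) = F.equiv (f.mapRange (delta1 ℬ) (map_zero _)) := by
  induction f using Finsupp.induction_linear with
  | zero => simp
  | add f g hf hg =>
    rw [map_add, map_add, hf, hg, ← map_add, Finsupp.mapRange_add (map_add _)]
  | single n x =>
    rw [Finsupp.mapRange_single]
    induction x using TensorProduct.induction_on with
    | zero => simp
    | add x y hx hy => simp only [Finsupp.single_add, map_add] at *; rw [hx, hy]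
    | tmul b t =>
      rw [lam_single_tmul, F.equiv_single]
      simp [delta1, extendScalars_tmul, presentation_θ, mul_assoc]

/-- Identifies the terms of the complex over `A` with finitely supported families of elements of the
corresponding terms over `B`, by expanding the `A`-factor in the basis `u`. -/
theorem mem_baseChange_map_θ (J : Submodule k (TensorAlgebra k (ℬ 1)))
    (x : A ⊗[k] TensorAlgebra k (𝒜 1)) :
    x ∈ (J.map F.θ.toLinearMap).baseChange A ↔ ∃ f, (∀ n, f n ∈ J.baseChange B) ∧ F.lam f = x := by
  constructor
  · rintro ⟨y, rfl⟩
    induction y using TensorProduct.induction_on with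
    | zero => exact ⟨0, fun n => by simp, by simp⟩
    | add y z hy hz =>
      obtain ⟨f, hf, hf'⟩ := hy
      obtain ⟨g, hg, hg'⟩ := hz
      exact ⟨f + g, fun n => add_mem (hf n) (hg n), by rw [map_add, hf', hg', ← map_add]⟩
    | tmul a j =>
      obtain ⟨_, j, hj, rfl⟩ := j
      obtain ⟨g, rfl⟩ := F.equiv.surjective a
      refine ⟨g.mapRange (fun b => b ⊗ₜ j) (by simp), fun n => ?_, ?_⟩
      · rw [Finsupp.mapRange_apply]
        exact Submodule.tmul_mem_baseChange_of_mem _ hj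
      · rw [LinearMap.baseChange_tmul]
        change _ = F.equiv g ⊗ₜ F.θ j
        induction g using Finsupp.induction_linear with
        | zero => simp
        | add f g hf hg =>
          rw [Finsupp.mapRange_add (fun _ _ => TensorProduct.add_tmul _ _ _), map_add, hf, hg,
            map_add, TensorProduct.add_tmul]
        | single n b => rw [Finsupp.mapRange_single, lam_single_tmul, F.equiv_single]
  · rintro ⟨f, hf, rfl⟩
    rw [lam, Finsupp.lsum_apply]
    refine Submodule.sum_mem _ fun n _ => ?_
    obtain ⟨y, hy⟩ := hf n
    dsimp only
    rw [← hy]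
    clear hy
    induction y using TensorProduct.induction_on with
    | zero => simp
    | add y z hy hz => rw [map_add, map_add]; exact add_mem hy hz
    | tmul b j => exact Submodule.tmul_mem_baseChange_of_mem _ ⟨_, j.2, rfl⟩

/-- If `f` takes values in the image of `g`, then it is obtained by applying `g` to the values of
a function. -/
theorem exists_mapRange_eq {X Y : Type*} [AddCommGroup X] [AddCommGroup Y]
    (g : X → Y) (h0 : g 0 = 0) (p : X → Prop) (hp : p 0) (f : N →₀ Y)
    (h : ∀ n, ∃ x, p x ∧ g x = f n) :
    ∃ f' : N →₀ X, (∀ n, p (f' n)) ∧ f'.mapRange g h0 = f := by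
  classical
  choose x hx hx' using h
  refine ⟨Finsupp.onFinset f.support (fun n => if f n = 0 then 0 else x n) fun n hn => ?_,
    fun n => ?_, ?_⟩
  · rw [Finsupp.mem_support_iff]; rintro h; simp [h] at hn
  · rw [Finsupp.onFinset_apply]; split_ifs with h; exacts [hp, hx n]
  · ext n
    rw [Finsupp.mapRange_apply, Finsupp.onFinset_apply]; split_ifs with h; exacts [h0.trans h.symm, hx' n]

theorem exists_shift_pow_eq (p : ℕ) (J' : Submodule k (TensorAlgebra k (ℬ 1)))
    (f : N →₀ B ⊗[k] TensorAlgebra k (ℬ 1))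
    (hf : ∀ n, f n ∈ (J'.baseChange B).map (shift ℬ ^ p)) :
    ∃ y ∈ (J'.map F.θ.toLinearMap).baseChange A, (shift 𝒜 ^ p) y = F.lam f := by
  obtain ⟨g, hg, rfl⟩ := exists_mapRange_eq (shift ℬ ^ p : Module.End B _) (map_zero _)
    (· ∈ J'.baseChange B) (zero_mem _) f hf
  exact ⟨F.lam g, (F.mem_baseChange_map_θ J' _).2 ⟨g, hg, rfl⟩, F.shift_pow_lam p g⟩

/-- Exactness is preserved by free extensions. -/
theorem exact_shift (p q : ℕ) (J J' : Submodule k (TensorAlgebra k (ℬ 1)))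
    (h : (J'.baseChange B).map (shift ℬ ^ p) =
      J.baseChange B ⊓ LinearMap.ker (shift ℬ ^ q : Module.End B _)) :
    ((J'.map F.θ.toLinearMap).baseChange A).map (shift 𝒜 ^ p) =
      (J.map F.θ.toLinearMap).baseChange A ⊓ LinearMap.ker (shift 𝒜 ^ q : Module.End A _) := by
  apply le_antisymm
  · rintro _ ⟨y, hy, rfl⟩
    obtain ⟨f, hf, rfl⟩ := (F.mem_baseChange_map_θ J' y).1 hy
    have h' : ∀ n, (shift ℬ ^ p) (f n) ∈ J.baseChange B ⊓ LinearMap.ker (shift ℬ ^ q) :=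
      fun n => h ▸ ⟨f n, hf n, rfl⟩
    rw [shift_pow_lam]
    refine ⟨(F.mem_baseChange_map_θ J _).2 ⟨_, fun n => ?_, rfl⟩, ?_⟩
    · exact (h' n).1
    · change (shift 𝒜 ^ q) (F.lam _) = 0
      rw [shift_pow_lam]
      convert map_zero F.lam
      ext n
      exact (h' n).2
  · rintro x ⟨hx, hx'⟩
    obtain ⟨f, hf, rfl⟩ := (F.mem_baseChange_map_θ J x).1 hx
    change (shift 𝒜 ^ q) (F.lam _) = 0 at hx'
    rw [shift_pow_lam] at hx'
    -- Being a cycle can be tested on coordinates, and exactness over `B` then applies to each of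
    -- them.
    have hx' := F.lam_injective (hx'.trans (map_zero _).symm)
    obtain ⟨y, hy, hy'⟩ := F.exists_shift_pow_eq p J' f fun n =>
      h ▸ ⟨hf n, DFunLike.congr_fun hx' n⟩
    exact ⟨y, hy, hy'⟩

end FreeExtension

/-! ### The spaces `J_i` and direct summands -/

section KoszulJ

variable {k : Type u} [Field k] {V W : Type*} [AddCommGroup V] [Module k V]
  [AddCommGroup W] [Module k W]

/-- The endomorphism `f` applied to the first `n` letters. -/
def prefixMap (f : V →ₗ[k] V) : ℕ → TensorAlgebra k V →ₗ[k] TensorAlgebra k V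
  | 0 => LinearMap.id
  | n + 1 => LinearMap.mul' k (TensorAlgebra k V) ∘ₗ
      TensorProduct.map (TensorAlgebra.ι k ∘ₗ f) (prefixMap f n) ∘ₗ uncons k V

theorem prefixMap_succ_ι_mul (f : V →ₗ[k] V) (n : ℕ) (v : V) (t : TensorAlgebra k V) :
    prefixMap f (n + 1) (TensorAlgebra.ι k v * t) = TensorAlgebra.ι k (f v) * prefixMap f n t := by
  simp [prefixMap, uncons_ι_mul]

theorem prefixMap_mul (f : V →ₗ[k] V) {n : ℕ} {a : TensorAlgebra k V} (ha : a ∈ tensorPow k V n)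
    (t : TensorAlgebra k V) : prefixMap f n (a * t) = tensorMap f a * t := by
  induction n generalizing a with
  | zero =>
    rw [tensorPow_zero] at ha
    obtain ⟨c, rfl⟩ := Submodule.mem_one.1 ha
    simp [prefixMap]
  | succ n ih =>
    rw [add_comm, tensorPow_add, tensorPow_one] at ha
    induction ha using Submodule.mul_induction_on' with
    | mem_mul_mem x hx y hy =>
      obtain ⟨v, rfl⟩ := hx
      rw [mul_assoc, prefixMap_succ_ι_mul, ih hy, map_mul, tensorMap_ι, mul_assoc]
    | add x _ y _ hx hy => rw [add_mul, map_add, hx, hy, map_add, add_mul]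

/-- The letters in positions `j + 1, …, j + m` form an element of `Q`, which `f` fixes; extending
the prefix over them changes nothing. -/
theorem prefixMap_add_eq (f : V →ₗ[k] V) {j m : ℕ} {Q : Submodule k (TensorAlgebra k V)}
    (hQ : Q ≤ tensorPow k V m) (hf : ∀ q ∈ Q, tensorMap f q = q) {x : TensorAlgebra k V}
    (hx : x ∈ tensorPow k V j * Q * ⊤) : prefixMap f (j + m) x = prefixMap f j x := by
  induction hx using Submodule.mul_induction_on' with
  | mem_mul_mem x hx c hc =>
    induction hx using Submodule.mul_induction_on' with
    | mem_mul_mem a ha b hb =>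
      have hab : a * b ∈ tensorPow k V (j + m) := by
        rw [tensorPow_add]; exact Submodule.mul_mem_mul ha (hQ hb)
      rw [prefixMap_mul f hab, map_mul, hf b hb, mul_assoc a b c, prefixMap_mul f ha, mul_assoc]
    | add x _ y _ hx hy => rw [add_mul, map_add, map_add, hx, hy]
  | add x _ y _ hx hy => rw [map_add, map_add, hx, hy]

theorem koszulDeg_ge {s i : ℕ} (hi : 2 ≤ i) : s ≤ koszulDeg s i := by
  rw [koszulDeg]
  exact le_add_right (Nat.le_mul_of_pos_right s (by omega))

theorem koszulJ_le {s : ℕ} {R : Submodule k (TensorAlgebra k V)} {i j : ℕ}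
    (hj : j ≤ koszulDeg s i - s) :
    koszulJ k V s R i ≤ tensorPow k V j * R * tensorPow k V (koszulDeg s i - s - j) :=
  iInf₂_le j (Finset.mem_range.2 (by omega))

theorem koszulJ_le_tensorPow {s : ℕ} {R : Submodule k (TensorAlgebra k V)}
    (hR : R ≤ tensorPow k V s) {i : ℕ} (hi : 2 ≤ i) :
    koszulJ k V s R i ≤ tensorPow k V (koszulDeg s i) := by
  refine (koszulJ_le (Nat.zero_le _)).trans ((mul_le_mul' (mul_le_mul' le_rfl hR) le_rfl).trans ?_)
  rw [← tensorPow_add, ← tensorPow_add]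
  have := koszulDeg_ge (s := s) hi
  exact le_of_eq (congrArg _ (by omega))

theorem map_tensorMap_mul_le (f : V →ₗ[k] W) (R : Submodule k (TensorAlgebra k V)) (a b : ℕ) :
    (tensorPow k V a * R * tensorPow k V b).map (tensorMap f).toLinearMap ≤
      tensorPow k W a * R.map (tensorMap f).toLinearMap * tensorPow k W b := by
  rw [Submodule.map_mul, Submodule.map_mul]
  exact mul_le_mul' (mul_le_mul' (tensorPow_map_le f a) le_rfl) (tensorPow_map_le f b)

theorem map_koszulJ_le (f : V →ₗ[k] W) (s : ℕ) (R : Submodule k (TensorAlgebra k V)) (i : ℕ) :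
    (koszulJ k V s R i).map (tensorMap f).toLinearMap ≤
      koszulJ k W s (R.map (tensorMap f).toLinearMap) i := by
  refine le_iInf₂ fun j hj => ?_
  refine (Submodule.map_mono (koszulJ_le ?_)).trans (map_tensorMap_mul_le f R _ _)
  have := Finset.mem_range.1 hj
  omega

/-- The spaces `J_i` do not depend on the ambient vector space. -/
theorem koszulJ_map (f : V →ₗ[k] W) (g : W →ₗ[k] V) (hgf : ∀ v, g (f v) = v) {s : ℕ} (hs : 1 ≤ s)
    {R : Submodule k (TensorAlgebra k V)} (hR : R ≤ tensorPow k V s) {i : ℕ} (hi : 2 ≤ i) :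
    koszulJ k W s (R.map (tensorMap f).toLinearMap) i =
      (koszulJ k V s R i).map (tensorMap f).toLinearMap := by
  have hgf' : ∀ t, tensorMap g (tensorMap f t) = t := fun t => by
    have : (tensorMap g).comp (tensorMap f) = AlgHom.id k _ := by ext v; simp [hgf]
    exact AlgHom.congr_fun this t
  have hfg : ∀ t, tensorMap (f ∘ₗ g) t = tensorMap f (tensorMap g t) := fun t => by
    have : tensorMap (f ∘ₗ g) = (tensorMap f).comp (tensorMap g) := by ext v; simp
    exact AlgHom.congr_fun this t
  have hRR : (R.map (tensorMap f).toLinearMap).map (tensorMap g).toLinearMap = R := by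
    ext t
    constructor
    · rintro ⟨_, ⟨t, ht, rfl⟩, rfl⟩
      rw [AlgHom.toLinearMap_apply, AlgHom.toLinearMap_apply, hgf']
      exact ht
    · exact fun ht => ⟨_, ⟨t, ht, rfl⟩, hgf' t⟩
  refine le_antisymm (fun x hx => ?_) (map_koszulJ_le f s R i)
  have hR' : R.map (tensorMap f).toLinearMap ≤ tensorPow k W s :=
    (Submodule.map_mono hR).trans (tensorPow_map_le f s)
  have hn := koszulDeg_ge (s := s) hi
  have hfix : ∀ m, ∀ q ∈ (tensorPow k V m).map (tensorMap f).toLinearMap,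
      tensorMap (f ∘ₗ g) q = q := by
    rintro m _ ⟨q, -, rfl⟩
    change tensorMap (f ∘ₗ g) (tensorMap f q) = tensorMap f q
    rw [hfg, hgf']
  -- `f ∘ₗ g` is a projection of `W` onto the image of `V`. The `j`-th space of the intersection has
  -- a relation starting at letter `j + 1`, so this letter is in that image; `1 ≤ s` ensures that a
  -- relation has a first letter.
  have key : ∀ j ≤ koszulDeg s i - s, prefixMap (f ∘ₗ g) j x = x := by
    intro j hj
    induction j with
    | zero => rfl
    | succ j ih =>
      rw [prefixMap_add_eq (f ∘ₗ g) (tensorPow_map_le f 1) (hfix 1) (j := j), ih (by omega)]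
      refine (koszulJ_le (j := j) (by omega)).trans ?_ hx
      obtain ⟨s, rfl⟩ := Nat.exists_eq_add_of_le hs
      rw [tensorPow_add] at hR
      refine (mul_le_mul' (mul_le_mul' le_rfl (Submodule.map_mono hR)) le_rfl).trans ?_
      rw [Submodule.map_mul, ← mul_assoc, mul_assoc _ _ (tensorPow k W _)]
      exact mul_le_mul' le_rfl le_top
  -- The first letters of relations reach only position `koszulDeg s i - s + 1`; the final `s`
  -- letters are fixed together, as they form a whole relation in the last space of the
  -- intersection.
  have h2 : tensorMap (f ∘ₗ g) x = x := by
    have h3 := prefixMap_mul (f ∘ₗ g) (koszulJ_le_tensorPow hR' hi hx) 1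
    rw [mul_one, mul_one] at h3
    rw [← h3, ← Nat.sub_add_cancel hn, prefixMap_add_eq (f ∘ₗ g) hR'
      (fun q hq => hfix s q (Submodule.map_mono hR hq)), key _ le_rfl]
    exact (koszulJ_le le_rfl).trans (mul_le_mul' le_rfl le_top) hx
  refine ⟨tensorMap g x, ?_, (hfg x).symm.trans h2⟩
  have := map_koszulJ_le g s _ i ⟨x, hx, rfl⟩
  rwa [hRR] at this

end KoszulJ

/-! ### Connected graded algebras -/

section Connected

variable {k : Type u} [Field k] {A : Type*} [Ring A] [Algebra k A]
  {𝒜 : ℕ → Submodule k A} [GradedAlgebra 𝒜]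

theorem projZeroRingHom_of_mem {n : ℕ} (hn : n ≠ 0) {a : A} (ha : a ∈ 𝒜 n) :
    GradedRing.projZeroRingHom 𝒜 a = 0 :=
  DirectSum.decompose_of_mem_ne 𝒜 ha hn

theorem projZeroRingHom_algebraMap (c : k) :
    GradedRing.projZeroRingHom 𝒜 (algebraMap k A c) = algebraMap k A c :=
  DirectSum.decompose_of_mem_same 𝒜 (SetLike.algebraMap_mem_graded 𝒜 c)

theorem IsConnected.exists_algebraMap_eq (h : IsConnected 𝒜) (a : A) :
    ∃ c : k, algebraMap k A c = GradedRing.projZeroRingHom 𝒜 a := by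
  have : GradedRing.projZeroRingHom 𝒜 a ∈ 𝒜 0 := SetLike.coe_mem _
  rw [h.1] at this
  exact Submodule.mem_one.1 this

/-- The augmentation of a connected graded algebra. -/
def IsConnected.augmentation (h : IsConnected 𝒜) : A →ₐ[k] k :=
  have inj : Function.Injective (algebraMap k A) :=
    have := h.2
    (algebraMap k A).injective
  have spec (a : A) := (h.exists_algebraMap_eq a).choose_spec
  AlgHom.mk
    { toFun := fun a => (h.exists_algebraMap_eq a).choose
      map_one' := inj (by rw [spec, map_one, map_one])
      map_mul' := fun a b => inj (by rw [spec, map_mul, map_mul, spec, spec])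
      map_zero' := inj (by rw [spec, map_zero, map_zero])
      map_add' := fun a b => inj (by rw [spec, map_add, map_add, spec, spec]) }
    fun c => inj (by
      change algebraMap k A (h.exists_algebraMap_eq _).choose = _
      rw [spec, projZeroRingHom_algebraMap]; rfl)

theorem IsConnected.algebraMap_augmentation (h : IsConnected 𝒜) (a : A) :
    algebraMap k A (h.augmentation a) = GradedRing.projZeroRingHom 𝒜 a :=
  (h.exists_algebraMap_eq a).choose_spec

theorem IsConnected.augmentation_eq_zero (h : IsConnected 𝒜) {a : A}
    (ha : GradedRing.projZeroRingHom 𝒜 a = 0) : h.augmentation a = 0 := by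
  have := h.2
  refine (algebraMap k A).injective ?_
  rw [h.algebraMap_augmentation, ha, map_zero]

theorem IsConnected.augmentation_of_mem (h : IsConnected 𝒜) {n : ℕ} (hn : n ≠ 0) {a : A}
    (ha : a ∈ 𝒜 n) : h.augmentation a = 0 :=
  h.augmentation_eq_zero (projZeroRingHom_of_mem hn ha)

omit [GradedAlgebra 𝒜] in
theorem presentation_ι (v : 𝒜 1) : presentation 𝒜 (TensorAlgebra.ι k v) = v := by
  simp [presentation]

omit [GradedAlgebra 𝒜] in
theorem delta1_tmul (a : A) (t : TensorAlgebra k (𝒜 1)) :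
    delta1 𝒜 (a ⊗ₜ t) = a * presentation 𝒜 t := rfl

/-- The end of the complex is exact if the algebra is generated in degree one. -/
theorem map_delta1_complexOne (h : Function.Surjective (presentation 𝒜)) :
    (complexOne 𝒜).map (delta1 𝒜) = RingHom.ker (GradedRing.projZeroRingHom 𝒜) := by
  have mem_v : ∀ v : 𝒜 1, (v : A) ∈ (complexOne 𝒜).map (delta1 𝒜) := fun v => by
    refine ⟨1 ⊗ₜ TensorAlgebra.ι k v, Submodule.tmul_mem_baseChange_of_mem _ ?_, ?_⟩
    · rw [tensorPow_one]; exact ⟨v, rfl⟩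
    · rw [delta1_tmul, one_mul, presentation_ι]
  have hle : (complexOne 𝒜).map (delta1 𝒜) ≤ RingHom.ker (GradedRing.projZeroRingHom 𝒜) := by
    rintro _ ⟨_, ⟨y, rfl⟩, rfl⟩
    induction y using TensorProduct.induction_on with
    | zero => simp
    | add y z hy hz => rw [map_add, map_add]; exact add_mem hy hz
    | tmul a t =>
      obtain ⟨t, ht⟩ := t
      rw [tensorPow_one] at ht
      obtain ⟨v, rfl⟩ := ht
      rw [LinearMap.baseChange_tmul, Submodule.subtype_apply, delta1_tmul, presentation_ι,
        RingHom.mem_ker, map_mul, projZeroRingHom_of_mem one_ne_zero v.2, mul_zero]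
  apply le_antisymm hle
  -- Modulo the left ideal generated by `A₁`, every element of the image of `T(A₁)` is a scalar. For
  -- an element without degree zero part, this scalar vanishes in `A`.
  · have key : ∀ t, ∃ c : k, presentation 𝒜 t - algebraMap k A c ∈
        (complexOne 𝒜).map (delta1 𝒜) := by
      intro t
      induction t using tensorAlgebra_left_induction with
      | one => exact ⟨1, by simp⟩
      | ι_mul v t ih =>
        obtain ⟨c, hc⟩ := ih
        refine ⟨0, ?_⟩
        have h1 := Submodule.smul_mem _ (v : A) hc
        have h2 := Submodule.smul_mem _ (algebraMap k A c) (mem_v v)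
        have h3 := add_mem h1 h2
        rw [smul_eq_mul, smul_eq_mul, Algebra.commutes, mul_sub, sub_add_cancel] at h3
        rwa [map_mul, presentation_ι, map_zero, sub_zero]
      | add x y hx hy =>
        obtain ⟨c, hc⟩ := hx
        obtain ⟨d, hd⟩ := hy
        refine ⟨c + d, ?_⟩
        rw [map_add, map_add, add_sub_add_comm]
        exact add_mem hc hd
      | smul r x hx =>
        obtain ⟨c, hc⟩ := hx
        refine ⟨r * c, ?_⟩
        have := Submodule.smul_mem _ (algebraMap k A r) hc
        rwa [smul_eq_mul, mul_sub, ← map_mul, ← Algebra.smul_def, ← map_smul] at this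
    intro a ha
    obtain ⟨t, rfl⟩ := h a
    obtain ⟨c, hc⟩ := key t
    suffices algebraMap k A c = 0 by rwa [this, sub_zero] at hc
    have h1 := RingHom.mem_ker.1 (hle hc)
    rw [map_sub, RingHom.mem_ker.1 ha, zero_sub, neg_eq_zero, projZeroRingHom_algebraMap] at h1
    exact h1

end Connected

/-! ### The free product of connected graded algebras -/

section FreeProductGraded

open LinearAlgebra

variable {k : Type u} [Field k] {I : Type} [DecidableEq I]
  {B : I → Type v} [∀ i, Ring (B i)] [∀ i, Algebra k (B i)]
  {ℬ : ∀ i, ℕ → Submodule k (B i)} [∀ i, GradedAlgebra (ℬ i)]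

-- In total degree `0` all factors are scalars by connectedness; in total degree `1` all but one
-- are. The induction for degree `1` uses the degree `0` statement for the tail.
omit [∀ i, GradedAlgebra (ℬ i)] in
theorem freeProduct_prod_mem (h : ∀ i, IsConnected (ℬ i)) (l : List (Σ i, Σ m, ℬ i m)) :
    ((l.map fun p => p.2.1).sum = 0 →
      (l.map fun p => FreeProduct.ι k B p.1 (p.2.2 : B p.1)).prod ∈
        (1 : Submodule k (FreeProduct k B))) ∧
    ((l.map fun p => p.2.1).sum = 1 →
      (l.map fun p => FreeProduct.ι k B p.1 (p.2.2 : B p.1)).prod ∈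
        ⨆ i, (ℬ i 1).map (FreeProduct.ι k B i).toLinearMap) := by
  induction l with
  | nil => exact ⟨fun _ => Submodule.one_le.1 le_rfl, fun h => absurd h (by simp)⟩
  | cons p l ih =>
    obtain ⟨i, m, b, hb⟩ := p
    simp only [List.map_cons, List.sum_cons, List.prod_cons]
    have zero_mem : m = 0 → ∃ c : k, FreeProduct.ι k B i b = algebraMap k _ c := by
      rintro rfl
      rw [(h i).1] at hb
      obtain ⟨c, rfl⟩ := Submodule.mem_one.1 hb
      exact ⟨c, AlgHom.commutes _ c⟩
    constructor
    · intro hm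
      obtain ⟨c, hc⟩ := zero_mem (by omega)
      rw [hc, ← Algebra.smul_def]
      exact Submodule.smul_mem _ _ (ih.1 (by omega))
    · intro hm
      obtain (h0 | h1) : m = 0 ∨ m = 1 := by omega
      · obtain ⟨c, hc⟩ := zero_mem h0
        rw [hc, ← Algebra.smul_def]
        exact Submodule.smul_mem _ _ (ih.2 (by omega))
      · subst h1
        obtain ⟨c, hc⟩ := Submodule.mem_one.1 (ih.1 (by omega))
        rw [← hc, ← Algebra.commutes, ← Algebra.smul_def]
        exact Submodule.smul_mem _ _ (Submodule.mem_iSup_of_mem i ⟨b, hb, rfl⟩)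

omit [∀ i, GradedAlgebra (ℬ i)] in
theorem freeProductGrading_zero (h : ∀ i, IsConnected (ℬ i)) :
    freeProductGrading ℬ 0 = 1 := by
  refine le_antisymm (Submodule.span_le.2 ?_)
    (Submodule.one_le.2 (SetLike.GradedOne.one_mem (A := freeProductGrading ℬ)))
  rintro _ ⟨l, hl, rfl⟩
  exact (freeProduct_prod_mem h l).1 hl

omit [∀ i, GradedAlgebra (ℬ i)] in
theorem freeProductGrading_one (h : ∀ i, IsConnected (ℬ i)) :
    freeProductGrading ℬ 1 = ⨆ i, (ℬ i 1).map (FreeProduct.ι k B i).toLinearMap := by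
  refine le_antisymm (Submodule.span_le.2 ?_) (iSup_le fun i => ?_)
  · rintro _ ⟨l, hl, rfl⟩
    exact (freeProduct_prod_mem h l).2 hl
  · rintro _ ⟨b, hb, rfl⟩
    exact ι_mem_freeProductGrading ℬ i 1 ⟨b, hb⟩

omit [∀ i, GradedAlgebra (ℬ i)] in
theorem exists_inclComponent_eq (h : ∀ i, IsConnected (ℬ i))
    {p : freeProductGrading ℬ 1 → Prop} (zero : p 0)
    (incl : ∀ i v, p (inclComponent ℬ i 1 v)) (add : ∀ x y, p x → p y → p (x + y))
    (v : freeProductGrading ℬ 1) : p v := by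
  obtain ⟨v, hv⟩ := v
  have hv' := hv
  rw [freeProductGrading_one h] at hv'
  induction hv' using Submodule.iSup_induction' with
  | mem i x hx =>
    obtain ⟨b, hb, rfl⟩ := hx
    exact incl i ⟨b, hb⟩
  | zero => exact zero
  | add x y hx hy ihx ihy =>
    rw [← freeProductGrading_one h] at hx hy
    exact add _ _ (ihx hx) (ihy hy)

theorem freeProduct_isConnected (h : ∀ i, IsConnected (ℬ i)) :
    IsConnected (freeProductGrading ℬ) :=
  ⟨freeProductGrading_zero h,
    (FreeProduct.lift k B fun {i} => (h i).augmentation).toRingHom.domain_nontrivial⟩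

omit [∀ i, GradedAlgebra (ℬ i)] in
theorem freeProduct_finite [Finite I] (h : ∀ i, IsConnected (ℬ i))
    (hf : ∀ i, Module.Finite k (ℬ i 1)) : Module.Finite k (freeProductGrading ℬ 1) := by
  rw [freeProductGrading_one h]
  infer_instance

theorem freeProductProj_mem (h : ∀ i, IsConnected (ℬ i)) (i : I) (v : freeProductGrading ℬ 1) :
    freeProductProj (fun i => (h i).augmentation) i v ∈ ℬ i 1 := by
  induction v using exists_inclComponent_eq h with
  | zero => simp
  | incl j v =>
    change freeProductProj _ i (FreeProduct.ι k B j v) ∈ _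
    by_cases hij : j = i
    · subst hij
      rw [freeProductProj_ι_self]
      exact v.2
    · rw [freeProductProj_ι_of_ne _ hij, (h j).augmentation_of_mem one_ne_zero v.2, map_zero]
      exact zero_mem _
  | add x y hx hy => rw [Submodule.coe_add, map_add]; exact add_mem hx hy

/-- The projection of the degree one part of a free product on the degree one part of a factor. -/
def projComponent (h : ∀ i, IsConnected (ℬ i)) (i : I) : freeProductGrading ℬ 1 →ₗ[k] ℬ i 1 :=
  ((freeProductProj (fun i => (h i).augmentation) i).toLinearMap ∘ₗ
    (freeProductGrading ℬ 1).subtype).codRestrict _ (freeProductProj_mem h i)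

theorem projComponent_self (h : ∀ i, IsConnected (ℬ i)) (i : I) (v : ℬ i 1) :
    projComponent h i (inclComponent ℬ i 1 v) = v :=
  Subtype.ext (freeProductProj_ι_self _ i _)

theorem projComponent_of_ne (h : ∀ i, IsConnected (ℬ i)) {i j : I} (hij : j ≠ i) (v : ℬ j 1) :
    projComponent h i (inclComponent ℬ j 1 v) = 0 := by
  refine Subtype.ext ((freeProductProj_ι_of_ne _ hij (v : B j)).trans ?_)
  rw [(h j).augmentation_of_mem one_ne_zero v.2, map_zero]
  rfl

/-- A free product is a free extension of its factors. -/
def freeProductExtension (h : ∀ i, IsConnected (ℬ i)) (i : I) :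
    FreeExtension (N := RedWordAvoiding (fun i => (h i).augmentation) i)
      (freeProductGrading ℬ) (ℬ i) where
  φ := FreeProduct.ι k B i
  inc := inclComponent ℬ i 1
  ρ := projComponent h i
  coe_inc _ := rfl
  ρ_inc := projComponent_self h i
  u w := wordValue _ w.1.1
  equiv := LinearEquiv.ofBijective _ (freeProductCombination_bijective _ i)
  equiv_single w b := freeProductCombination_single _ i w b

theorem freeProductExtension_inc (h : ∀ i, IsConnected (ℬ i)) (i : I) (v : ℬ i 1) :
    (freeProductExtension h i).inc v = inclComponent ℬ i 1 v := rfl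

theorem freeProductExtension_ρ (h : ∀ i, IsConnected (ℬ i)) (i : I)
    (v : freeProductGrading ℬ 1) :
    (freeProductExtension h i).ρ v = projComponent h i v := rfl

theorem freeProductExtension_θ_ι (h : ∀ i, IsConnected (ℬ i)) (i : I) (v : ℬ i 1) :
    (freeProductExtension h i).θ (TensorAlgebra.ι k v) =
      TensorAlgebra.ι k (inclComponent ℬ i 1 v) := by
  rw [FreeExtension.θ_ι, freeProductExtension_inc]

theorem freeProduct_presentation_surjective (h : ∀ i, IsConnected (ℬ i))
    (hs : ∀ i, Function.Surjective (presentation (ℬ i))) :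
    Function.Surjective (presentation (freeProductGrading ℬ)) := by
  intro a
  induction a using freeProduct_induction with
  | algebraMap c => exact ⟨algebraMap k _ c, AlgHom.commutes _ c⟩
  | ι i b =>
    obtain ⟨t, rfl⟩ := hs i b
    exact ⟨_, (freeProductExtension h i).presentation_θ t⟩
  | add x y hx hy =>
    obtain ⟨x, rfl⟩ := hx
    obtain ⟨y, rfl⟩ := hy
    exact ⟨x + y, map_add _ x y⟩
  | mul x y hx hy =>
    obtain ⟨x, rfl⟩ := hx
    obtain ⟨y, rfl⟩ := hy
    exact ⟨x * y, map_mul _ x y⟩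

theorem exists_algHom_comp_eq {X Y Z : Type*} [Ring X] [Ring Y] [Ring Z] [Algebra k X]
    [Algebra k Y] [Algebra k Z] (f : X →ₐ[k] Y) (hf : Function.Surjective f) (g : X →ₐ[k] Z)
    (hfg : ∀ x, f x = 0 → g x = 0) : ∃ h : Y →ₐ[k] Z, ∀ x, h (f x) = g x := by
  let e := Ideal.quotientKerAlgEquivOfSurjective hf
  refine ⟨(Ideal.Quotient.liftₐ (RingHom.ker f) g fun x hx => hfg x hx).comp
    e.symm.toAlgHom, fun x => ?_⟩
  have : e.symm (f x) = Ideal.Quotient.mk _ x := by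
    rw [AlgEquiv.symm_apply_eq]
    rfl
  change Ideal.Quotient.liftₐ (RingHom.ker f) g (fun x hx => hfg x hx) (e.symm (f x)) = g x
  rw [this]
  rfl

/-- A presentation of the free product is given by the relations of the factors. -/
theorem ker_freeProduct_presentation (h : ∀ i, IsConnected (ℬ i))
    (hs : ∀ i, Function.Surjective (presentation (ℬ i)))
    (R : ∀ i, Submodule k (TensorAlgebra k (ℬ i 1)))
    (hR : ∀ i, LinearMap.ker (presentation (ℬ i)).toLinearMap = ⊤ * R i * ⊤) :
    LinearMap.ker (presentation (freeProductGrading ℬ)).toLinearMap =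
      ⨆ i, ⊤ * (R i).map (freeProductExtension h i).θ.toLinearMap * ⊤ := by
  set K : Submodule k (TensorAlgebra k (freeProductGrading ℬ 1)) :=
    ⨆ i, ⊤ * (R i).map (freeProductExtension h i).θ.toLinearMap * ⊤ with hK
  have top_mul_top : (⊤ : Submodule k (TensorAlgebra k (freeProductGrading ℬ 1))) * ⊤ ≤ ⊤ := le_top
  have left : ⊤ * K ≤ K := by
    rw [hK, Submodule.mul_iSup]
    refine iSup_mono fun i => ?_
    rw [← mul_assoc, ← mul_assoc]
    exact mul_le_mul' (mul_le_mul' top_mul_top le_rfl) le_rfl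
  have right : K * ⊤ ≤ K := by
    rw [hK, Submodule.iSup_mul]
    refine iSup_mono fun i => ?_
    rw [mul_assoc _ ⊤ ⊤]
    exact mul_le_mul' le_rfl top_mul_top
  apply le_antisymm
  · let J : Ideal (TensorAlgebra k (freeProductGrading ℬ 1)) :=
      { K.toAddSubmonoid with
        smul_mem' := fun a x hx => left (Submodule.mul_mem_mul Submodule.mem_top hx) }
    have : J.IsTwoSided :=
      ⟨fun b hx => right (Submodule.mul_mem_mul hx Submodule.mem_top)⟩
    -- Each `B i` maps to the quotient because its relations vanish there. The universal property
    -- glues these maps into one from the free product, through which the quotient map factors; so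
    -- whatever the presentation kills lies in `J`.
    have lift : ∀ i, ∃ g : B i →ₐ[k] TensorAlgebra k (freeProductGrading ℬ 1) ⧸ J,
        ∀ t, g (presentation (ℬ i) t) =
          Ideal.Quotient.mkₐ k J ((freeProductExtension h i).θ t) := fun i => by
      refine exists_algHom_comp_eq _ (hs i)
        ((Ideal.Quotient.mkₐ k J).comp (freeProductExtension h i).θ) fun t ht => ?_
      have ht : t ∈ ⊤ * R i * ⊤ := hR i ▸ ht
      refine Ideal.Quotient.eq_zero_iff_mem.2 ?_
      refine Submodule.mem_iSup_of_mem i ?_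
      have := Submodule.mem_map_of_mem (f := (freeProductExtension h i).θ.toLinearMap) ht
      rw [Submodule.map_mul, Submodule.map_mul] at this
      exact (mul_le_mul' (mul_le_mul' le_top le_rfl) le_top :
        _ ≤ ⊤ * (R i).map (freeProductExtension h i).θ.toLinearMap * ⊤) this
    choose g hg using lift
    have comp : ((FreeProduct.lift k B fun {i} => g i).comp
        (presentation (freeProductGrading ℬ))) = Ideal.Quotient.mkₐ k J := by
      ext v
      simp only [LinearMap.comp_apply, AlgHom.toLinearMap_apply, AlgHom.comp_apply, presentation_ι]
      induction v using exists_inclComponent_eq h with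
      | zero => simp only [Submodule.coe_zero, map_zero]
      | incl i v =>
        refine (freeProduct_lift_ι g i v).trans ?_
        rw [← presentation_ι, hg]
        rw [freeProductExtension_θ_ι]
      | add x y hx hy => rw [Submodule.coe_add, map_add, map_add, map_add, hx, hy]
    intro t ht
    have h0 := AlgHom.congr_fun comp t
    rw [AlgHom.comp_apply, show presentation (freeProductGrading ℬ) t = 0 from ht, map_zero] at h0
    exact Ideal.Quotient.eq_zero_iff_mem.1 h0.symm
  · refine iSup_le fun i => Submodule.mul_le.2 fun x hx c _ => ?_
    have : presentation (freeProductGrading ℬ) x = 0 := by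
      induction hx using Submodule.mul_induction_on' with
      | mem_mul_mem a _ r hr =>
        obtain ⟨r, hr, rfl⟩ := hr
        have hr' : r ∈ ⊤ * R i * ⊤ := by
          have := Submodule.mul_mem_mul (Submodule.mul_mem_mul
            (Submodule.mem_top (x := (1 : TensorAlgebra k (ℬ i 1)))) hr)
            (Submodule.mem_top (x := (1 : TensorAlgebra k (ℬ i 1))))
          rwa [one_mul, mul_one] at this
        rw [← hR i] at hr'
        rw [map_mul, AlgHom.toLinearMap_apply, FreeExtension.presentation_θ,
          show presentation (ℬ i) r = 0 from hr', map_zero, mul_zero]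
      | add x _ y _ hx hy => rw [map_add, hx, hy, add_zero]
    change presentation (freeProductGrading ℬ) (x * c) = 0
    rw [map_mul, this, zero_mul]

/-- The relations of one factor vanish under the projection on another one. -/
theorem ret_θ_of_ne (h : ∀ i, IsConnected (ℬ i)) {i j : I} (hij : j ≠ i) {s : ℕ} (hs : s ≠ 0)
    {t : TensorAlgebra k (ℬ j 1)} (ht : t ∈ tensorPow k (ℬ j 1) s) :
    (freeProductExtension h i).ret ((freeProductExtension h j).θ t) = 0 := by
  -- Positive length supplies a first letter, which the projection kills.
  obtain ⟨s, rfl⟩ := Nat.exists_eq_succ_of_ne_zero hs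
  rw [Nat.succ_eq_add_one, add_comm, tensorPow_add, tensorPow_one] at ht
  induction ht using Submodule.mul_induction_on' with
  | mem_mul_mem x hx y hy =>
    obtain ⟨v, rfl⟩ := hx
    rw [map_mul, map_mul]
    have : (freeProductExtension h i).ret ((freeProductExtension h j).θ (TensorAlgebra.ι k v)) =
        TensorAlgebra.ι k (projComponent h i (inclComponent ℬ j 1 v)) := by
      rw [freeProductExtension_θ_ι, FreeExtension.ret_ι, freeProductExtension_ρ]
    rw [this, projComponent_of_ne h hij, map_zero, zero_mul]
  | add x _ y _ hx hy => rw [map_add, map_add, hx, hy, add_zero]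

end FreeProductGraded

/-! ### The multi-Koszul complex of a free product -/

/-! ### Koszul algebras with relations in a single degree -/

section Singleton

variable {k : Type u} [Field k] {A : Type v} [Ring A] [Algebra k A]
  {𝒜 : ℕ → Submodule k A} [GradedAlgebra 𝒜]

omit [GradedAlgebra 𝒜] in
theorem mem_complexTerm {S : Finset ℕ} {R : S → Submodule k (TensorAlgebra k (𝒜 1))} {i : ℕ}
    {x : S → A ⊗[k] TensorAlgebra k (𝒜 1)} :
    x ∈ complexTerm 𝒜 R i ↔ ∀ s : S, x s ∈ (koszulJ k (𝒜 1) s (R s) i).baseChange A := by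
  simp [complexTerm, Submodule.mem_pi]

omit [GradedAlgebra 𝒜] in
theorem delta2_apply {S : Finset ℕ} (x : S → A ⊗[k] TensorAlgebra k (𝒜 1)) :
    delta2 𝒜 x = ∑ s : S, (shift 𝒜 ^ jump s 2) (x s) := by
  simp [delta2]

omit [GradedAlgebra 𝒜] in
theorem koszulJ_two {s : ℕ} {R : Submodule k (TensorAlgebra k (𝒜 1))} :
    koszulJ k (𝒜 1) s R 2 = R := by
  simp [koszulJ, koszulDeg, tensorPow_zero]

/-- The relations of an `s`-Koszul algebra, and the exactness of its Koszul complex. -/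
theorem IsKoszul.exists_relations {s : ℕ} (h : IsKoszul s 𝒜) :
    ∃ R : Submodule k (TensorAlgebra k (𝒜 1)), R ≤ tensorPow k (𝒜 1) s ∧
      LinearMap.ker (presentation 𝒜).toLinearMap = ⊤ * R * ⊤ ∧
      ((koszulJ k (𝒜 1) s R 2).baseChange A).map (shift 𝒜 ^ jump s 2) =
        complexOne 𝒜 ⊓ LinearMap.ker (delta1 𝒜) ∧
      ∀ i, 2 ≤ i → ((koszulJ k (𝒜 1) s R (i + 1)).baseChange A).map (shift 𝒜 ^ jump s (i + 1)) =
        (koszulJ k (𝒜 1) s R i).baseChange A ⊓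
          LinearMap.ker (shift 𝒜 ^ jump s i : Module.End A _) := by
  obtain ⟨R, hR, hres⟩ := h.exists_resolution
  let s₀ : ({s} : Finset ℕ) := ⟨s, Finset.mem_singleton_self s⟩
  have huniq : ∀ t : ({s} : Finset ℕ), t = s₀ := fun t => Subtype.ext (Finset.mem_singleton.1 t.2)
  have hmem : ∀ i (x : ({s} : Finset ℕ) → A ⊗[k] TensorAlgebra k (𝒜 1)),
      x ∈ complexTerm 𝒜 R i ↔ x s₀ ∈ (koszulJ k (𝒜 1) s (R s₀) i).baseChange A := fun i x => by
    rw [mem_complexTerm]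
    refine ⟨fun h => h s₀, fun h (t : ({s} : Finset ℕ)) => ?_⟩
    rw [huniq t]
    exact h
  have hd2 : ∀ x : ({s} : Finset ℕ) → A ⊗[k] TensorAlgebra k (𝒜 1),
      delta2 𝒜 x = (shift 𝒜 ^ jump s 2) (x s₀) := fun x => by
    rw [delta2_apply]
    exact Finset.sum_eq_single s₀ (fun t _ ht => absurd (huniq t) ht)
      fun hs => absurd (Finset.mem_univ s₀) hs
  refine ⟨R s₀, hR.le_pow s₀, ?_, ?_, fun i hi => ?_⟩
  · rw [hR.ker_eq]
    exact le_antisymm (iSup_le fun t => by rw [huniq t])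
      (le_iSup (fun t : ({s} : Finset ℕ) => ⊤ * R t * ⊤) s₀)
  · rw [← hres.exact_one]
    ext y
    constructor
    · rintro ⟨x, hx, rfl⟩
      exact ⟨fun _ => x, (hmem 2 _).2 hx, hd2 _⟩
    · rintro ⟨x, hx, rfl⟩
      exact ⟨x s₀, (hmem 2 x).1 hx, (hd2 x).symm⟩
  -- With a single index, the sum defining `δ₂` and the product defining the higher differentials
  -- have the same kernel condition, so `i = 2` and `i ≥ 3` merge.
  · have hd : ∀ x : ({s} : Finset ℕ) → A ⊗[k] TensorAlgebra k (𝒜 1),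
        x ∈ (complexTerm 𝒜 R (i + 1)).map (delta 𝒜 (i + 1)) ↔
          x ∈ complexTerm 𝒜 R i ∧ (shift 𝒜 ^ jump s i) (x s₀) = 0 := fun x => by
      obtain rfl | hi := hi.eq_or_lt
      · rw [hres.exact_two, Submodule.mem_inf, LinearMap.mem_ker, hd2]
      · rw [hres.exact_ge_three i hi, Submodule.mem_inf, LinearMap.mem_ker]
        refine and_congr_right fun _ => ⟨fun h => congrFun h s₀, fun h => funext fun t => ?_⟩
        rw [huniq t]
        exact h
    ext y
    rw [Submodule.mem_inf, LinearMap.mem_ker]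
    refine Iff.trans ⟨?_, ?_⟩ ((hd fun _ => y).trans (and_congr_left fun _ => hmem i _))
    · rintro ⟨x, hx, rfl⟩
      refine ⟨fun _ => x, (hmem _ _).2 hx, funext fun t => ?_⟩
      rw [huniq t]
      rfl
    · rintro ⟨x, hx, hxy⟩
      exact ⟨x s₀, (hmem _ x).1 hx, congrFun hxy s₀⟩

end Singleton

/-! ### The decomposition of `A ⊗ V` over the factors -/

section FreeProductResolution

open LinearAlgebra

variable {k : Type u} [Field k] {I : Type} [DecidableEq I]
  {B : I → Type v} [∀ i, Ring (B i)] [∀ i, Algebra k (B i)]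
  {ℬ : ∀ i, ℕ → Submodule k (B i)} [∀ i, GradedAlgebra (ℬ i)]

/-- The sum of the subspaces `A ⊗ V_i` of `A ⊗ V` is direct. -/
theorem eq_zero_of_sum_eq_zero [Fintype I] (h : ∀ i, IsConnected (ℬ i))
    (y : I → FreeProduct k B ⊗[k] TensorAlgebra k (freeProductGrading ℬ 1))
    (hy : ∀ i, y i ∈ ((tensorPow k (ℬ i 1) 1).map
      (freeProductExtension h i).θ.toLinearMap).baseChange (FreeProduct k B))
    (hsum : ∑ i, y i = 0) (i : I) : y i = 0 := by
  let r := (freeProductExtension h i).ret.toLinearMap.lTensor (FreeProduct k B)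
  let t := (freeProductExtension h i).θ.toLinearMap.lTensor (FreeProduct k B)
  -- The projection of `V` onto the `i`-th summand isolates `y i` in the sum: it kills the other
  -- terms, and `t` recovers `y i` from its image.
  have h1 : ∀ j, j ≠ i → r (y j) = 0 := by
    intro j hj
    obtain ⟨x, hx⟩ := hy j
    rw [← hx]
    clear hx
    induction x using TensorProduct.induction_on with
    | zero => simp
    | add x z hx hz => rw [map_add, map_add, hx, hz, add_zero]
    | tmul a v =>
      obtain ⟨_, v, hv, rfl⟩ := v
      change a ⊗ₜ (freeProductExtension h i).ret ((freeProductExtension h j).θ v) = 0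
      rw [ret_θ_of_ne h hj one_ne_zero hv, TensorProduct.tmul_zero]
  have h2 : t (r (y i)) = y i := by
    obtain ⟨x, hx⟩ := hy i
    rw [← hx]
    clear hx
    induction x using TensorProduct.induction_on with
    | zero => simp
    | add x z hx hz => simp only [map_add, hx, hz]
    | tmul a v =>
      obtain ⟨_, v, hv, rfl⟩ := v
      change a ⊗ₜ (freeProductExtension h i).θ
        ((freeProductExtension h i).ret ((freeProductExtension h i).θ v)) = _
      rw [FreeExtension.ret_θ]
      rfl
  have h3 := congrArg r hsum
  rw [map_sum, map_zero, Finset.sum_eq_single i (fun j _ => h1 j) (by simp)] at h3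
  rw [← h2, h3, map_zero]

theorem complexOne_le_iSup (h : ∀ i, IsConnected (ℬ i)) :
    complexOne (freeProductGrading ℬ) ≤ ⨆ i, ((tensorPow k (ℬ i 1) 1).map
      (freeProductExtension h i).θ.toLinearMap).baseChange (FreeProduct k B) := by
  rw [complexOne, Submodule.baseChange_eq_span, Submodule.span_le, tensorPow_one]
  rintro _ ⟨_, ⟨v, rfl⟩, rfl⟩
  rw [SetLike.mem_coe]
  induction v using exists_inclComponent_eq h with
  | zero => rw [map_zero, map_zero]; exact zero_mem _
  | add v w hv hw => rw [map_add, map_add]; exact add_mem hv hw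
  | incl i v =>
    have hv : TensorAlgebra.ι k (inclComponent ℬ i 1 v) ∈
        (tensorPow k (ℬ i 1) 1).map (freeProductExtension h i).θ.toLinearMap := by
      rw [← freeProductExtension_θ_ι h, tensorPow_one]
      exact ⟨_, ⟨v, rfl⟩, rfl⟩
    rw [TensorProduct.mk_apply]
    exact Submodule.mem_iSup_of_mem i (Submodule.tmul_mem_baseChange_of_mem 1 hv)

theorem exists_sum_eq_of_mem_complexOne [Fintype I] (h : ∀ i, IsConnected (ℬ i))
    {x : FreeProduct k B ⊗[k] TensorAlgebra k (freeProductGrading ℬ 1)}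
    (hx : x ∈ complexOne (freeProductGrading ℬ)) :
    ∃ y : I → FreeProduct k B ⊗[k] TensorAlgebra k (freeProductGrading ℬ 1),
      (∀ i, y i ∈ ((tensorPow k (ℬ i 1) 1).map
        (freeProductExtension h i).θ.toLinearMap).baseChange (FreeProduct k B)) ∧
      ∑ i, y i = x := by
  have hx' := complexOne_le_iSup h hx
  rw [← iSup_univ, ← Finset.coe_univ] at hx'
  simp only [Finset.mem_coe] at hx'
  obtain ⟨μ, hμ⟩ := (Submodule.mem_iSup_finset_iff_exists_sum _ _).1 hx'
  exact ⟨fun i => μ i, fun i => (μ i).2, hμ⟩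

end FreeProductResolution

/-! ### Gluing the induced complexes -/

section ResolutionOfExtensions

variable {k : Type u} [Field k] {A : Type*} [Ring A] [Algebra k A] {𝒜 : ℕ → Submodule k A}

theorem FreeExtension.koszulJ_map_θ {B N : Type*} [Ring B] [Algebra k B] {ℬ : ℕ → Submodule k B}
    (F : FreeExtension (N := N) 𝒜 ℬ) {s : ℕ} (hs : 1 ≤ s)
    {R : Submodule k (TensorAlgebra k (ℬ 1))} (hR : R ≤ tensorPow k (ℬ 1) s) {i : ℕ}
    (hi : 2 ≤ i) : koszulJ k (𝒜 1) s (R.map F.θ.toLinearMap) i =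
      (koszulJ k (ℬ 1) s R i).map F.θ.toLinearMap :=
  koszulJ_map F.inc F.ρ F.ρ_inc hs hR hi

/-- If the algebra `A` is a free extension of `s`-Koszul algebras `B s`, the degree one part and
the augmentation ideal of which generate those of `A` freely, then the multi-Koszul complex of `A`
is a resolution. -/
theorem isResolution_of_freeExtensions {S : Finset ℕ} [GradedAlgebra 𝒜] {B N : S → Type*}
    [∀ s, Ring (B s)] [∀ s, Algebra k (B s)] {ℬ : ∀ s, ℕ → Submodule k (B s)}
    [∀ s, GradedAlgebra (ℬ s)] (F : ∀ s, FreeExtension (N := N s) 𝒜 (ℬ s))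
    (hsurj : Function.Surjective (presentation 𝒜))
    (hsurj' : ∀ s, Function.Surjective (presentation (ℬ s)))
    (hsep : ∀ y : S → A ⊗[k] TensorAlgebra k (𝒜 1),
      (∀ s, y s ∈ ((tensorPow k (ℬ s 1) 1).map (F s).θ.toLinearMap).baseChange A) →
        ∑ s, y s = 0 → ∀ s, y s = 0)
    (hgen : ∀ x ∈ complexOne 𝒜, ∃ y : S → A ⊗[k] TensorAlgebra k (𝒜 1),
      (∀ s, y s ∈ ((tensorPow k (ℬ s 1) 1).map (F s).θ.toLinearMap).baseChange A) ∧
        ∑ s, y s = x)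
    (hind : ∀ f : ∀ s, N s →₀ B s, (∀ s n, GradedRing.projZeroRingHom (ℬ s) (f s n) = 0) →
      ∑ s, (F s).equiv (f s) = 0 → ∀ s, f s = 0)
    (hS : ∀ s ∈ S, 2 ≤ s) (R : ∀ s, Submodule k (TensorAlgebra k (ℬ s 1)))
    (hR : ∀ s : S, R s ≤ tensorPow k (ℬ s 1) s)
    (exact_one : ∀ s : S,
      ((koszulJ k (ℬ s 1) s (R s) 2).baseChange (B s)).map (shift (ℬ s) ^ jump s 2) =
        complexOne (ℬ s) ⊓ LinearMap.ker (delta1 (ℬ s)))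
    (exact_ge_two : ∀ (s : S) i, 2 ≤ i →
      ((koszulJ k (ℬ s 1) s (R s) (i + 1)).baseChange (B s)).map (shift (ℬ s) ^ jump s (i + 1)) =
        (koszulJ k (ℬ s 1) s (R s) i).baseChange (B s) ⊓
          LinearMap.ker (shift (ℬ s) ^ jump s i : Module.End (B s) _)) :
    IsResolution 𝒜 fun s : S => (R s).map (F s).θ.toLinearMap := by
  have hJ : ∀ (s : S) i, 2 ≤ i → koszulJ k (𝒜 1) s ((R s).map (F s).θ.toLinearMap) i =
      (koszulJ k (ℬ s 1) s (R s) i).map (F s).θ.toLinearMap := fun s i hi =>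
    (F s).koszulJ_map_θ (one_le_two.trans (hS s s.2)) (hR s) hi
  have hex : ∀ (s : S) i, 2 ≤ i →
      ((koszulJ k (𝒜 1) s ((R s).map (F s).θ.toLinearMap) (i + 1)).baseChange A).map
        (shift 𝒜 ^ jump s (i + 1)) =
      (koszulJ k (𝒜 1) s ((R s).map (F s).θ.toLinearMap) i).baseChange A ⊓
        LinearMap.ker (shift 𝒜 ^ jump s i : Module.End A _) := fun s i hi => by
    rw [hJ s i hi, hJ s (i + 1) (by omega)]
    exact (F s).exact_shift _ _ _ _ (exact_ge_two s i hi)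
  have map_delta : ∀ i, 2 ≤ i → ∀ x : S → A ⊗[k] TensorAlgebra k (𝒜 1),
      x ∈ (complexTerm 𝒜 (fun s : S => (R s).map (F s).θ.toLinearMap) (i + 1)).map
        (delta 𝒜 (i + 1)) ↔
      x ∈ complexTerm 𝒜 (fun s : S => (R s).map (F s).θ.toLinearMap) i ∧
        ∀ s : S, (shift 𝒜 ^ jump s i) (x s) = 0 := fun i hi x => by
    have hx : (x ∈ complexTerm 𝒜 (fun s : S => (R s).map (F s).θ.toLinearMap) i ∧
        ∀ s : S, (shift 𝒜 ^ jump s i) (x s) = 0) ↔ ∀ s : S, x s ∈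
          ((koszulJ k (𝒜 1) s ((R s).map (F s).θ.toLinearMap) (i + 1)).baseChange A).map
            (shift 𝒜 ^ jump s (i + 1)) := by
      rw [mem_complexTerm, ← forall_and]
      exact forall_congr' fun s => by rw [hex s i hi]; rfl
    rw [hx]
    constructor
    · rintro ⟨y, hy, rfl⟩ s
      exact ⟨y s, mem_complexTerm.1 hy s, rfl⟩
    · intro hx
      choose y hy hxy using hx
      exact ⟨y, mem_complexTerm.2 hy, funext hxy⟩
  -- On the `s`-component, `δ₂` is induced from `B s`, so its values are families of degree one
  -- cycles over `B s`. This gives both `δ₁ ∘ δ₂ = 0` and that the image lies in `A ⊗ V_s`.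
  have values : ∀ (s : S) (x : A ⊗[k] TensorAlgebra k (𝒜 1)),
      x ∈ (koszulJ k (𝒜 1) s ((R s).map (F s).θ.toLinearMap) 2).baseChange A →
      ∃ f, (∀ n, f n ∈ complexOne (ℬ s) ⊓ LinearMap.ker (delta1 (ℬ s))) ∧
        (F s).lam f = (shift 𝒜 ^ jump s 2) x := fun s x hx => by
    rw [hJ s 2 le_rfl, (F s).mem_baseChange_map_θ] at hx
    obtain ⟨f, hf, rfl⟩ := hx
    refine ⟨_, fun n => ?_, ((F s).shift_pow_lam _ f).symm⟩
    rw [← exact_one s]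
    exact ⟨f n, hf n, rfl⟩
  have shift_mem : ∀ (s : S) (x : A ⊗[k] TensorAlgebra k (𝒜 1)),
      x ∈ (koszulJ k (𝒜 1) s ((R s).map (F s).θ.toLinearMap) 2).baseChange A →
      (shift 𝒜 ^ jump s 2) x ∈
        ((tensorPow k (ℬ s 1) 1).map (F s).θ.toLinearMap).baseChange A := fun s x hx => by
    obtain ⟨f, hf, hfx⟩ := values s x hx
    exact ((F s).mem_baseChange_map_θ _ _).2 ⟨f, fun n => (hf n).1, hfx⟩
  refine ⟨map_delta1_complexOne hsurj, le_antisymm ?_ ?_, ?_, fun i hi => ?_⟩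
  · rintro _ ⟨x, hx, rfl⟩
    rw [delta2_apply]
    refine Submodule.sum_mem _ fun s _ => ⟨?_, ?_⟩
    · exact Submodule.baseChange_mono A (tensorPow_map_le (F s).inc 1)
        (shift_mem s _ (mem_complexTerm.1 hx s))
    · obtain ⟨f, hf, hfx⟩ := values s _ (mem_complexTerm.1 hx s)
      rw [← hfx, SetLike.mem_coe, LinearMap.mem_ker, FreeExtension.delta1_lam]
      refine (congrArg _ (Finsupp.ext fun n => ?_)).trans (map_zero (F s).equiv)
      exact (hf n).2
  · rintro x ⟨hx, hx'⟩
    obtain ⟨y, hy, rfl⟩ := hgen x hx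
    have hy' := fun s => ((F s).mem_baseChange_map_θ _ _).1 (hy s)
    choose f hf hfy using hy'
    have h0 : ∑ s, (F s).equiv ((f s).mapRange (delta1 (ℬ s)) (map_zero _)) = 0 := by
      rw [SetLike.mem_coe, LinearMap.mem_ker, map_sum] at hx'
      rw [← hx']
      exact Finset.sum_congr rfl fun s _ => by rw [← hfy, FreeExtension.delta1_lam]
    -- The coordinates of `δ₁ (y s)` lie in the augmentation ideal of `B s`, so independence makes
    -- every `δ₁ (y s)` vanish separately; exactness over `B s` then gives preimages.
    have h1 := hind _ (fun s n => by
      rw [Finsupp.mapRange_apply, ← RingHom.mem_ker, ← map_delta1_complexOne (hsurj' s)]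
      exact ⟨_, hf s n, rfl⟩) h0
    have h2 : ∀ s : S, ∃ z ∈ ((R s).map (F s).θ.toLinearMap).baseChange A,
        (shift 𝒜 ^ jump s 2) z = y s := fun s => by
      rw [← hfy s]
      refine (F s).exists_shift_pow_eq _ _ _ fun n => ?_
      rw [← koszulJ_two (s := s) (R := R s), exact_one s]
      exact ⟨hf s n, DFunLike.congr_fun (h1 s) n⟩
    choose z hz hzy using h2
    refine ⟨z, mem_complexTerm.2 fun s => ?_, ?_⟩
    · rw [koszulJ_two]
      exact hz s
    · rw [delta2_apply]
      exact Finset.sum_congr rfl fun s _ => hzy s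
  · ext x
    rw [map_delta 2 le_rfl, Submodule.mem_inf, LinearMap.mem_ker, delta2_apply]
    refine and_congr_right fun hx => ⟨fun h => Finset.sum_eq_zero fun s _ => h s, fun h => ?_⟩
    -- The components of `δ₂ x` lie in independent summands `A ⊗ V_s`, so a zero sum forces each to
    -- be zero.
    exact hsep _ (fun s => shift_mem s _ (mem_complexTerm.1 hx s)) h
  · ext x
    rw [map_delta i (by omega), Submodule.mem_inf, LinearMap.mem_ker]
    exact and_congr_right fun _ => ⟨fun h => funext h, fun h => congrFun h⟩

end ResolutionOfExtensions

/-! ### The space of relations of the free product -/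

section Main

open LinearAlgebra

variable {k : Type u} [Field k] {S : Finset ℕ}
  {B : S → Type v} [∀ i, Ring (B i)] [∀ i, Algebra k (B i)]
  {ℬ : ∀ i, ℕ → Submodule k (B i)} [∀ i, GradedAlgebra (ℬ i)]

theorem freeProduct_isRelationSpace (hS : ∀ s ∈ S, 2 ≤ s) (h : ∀ i, IsConnected (ℬ i))
    (hs : ∀ i, Function.Surjective (presentation (ℬ i)))
    (R : ∀ i, Submodule k (TensorAlgebra k (ℬ i 1)))
    (hRle : ∀ i : S, R i ≤ tensorPow k (ℬ i 1) i)
    (hR : ∀ i, LinearMap.ker (presentation (ℬ i)).toLinearMap = ⊤ * R i * ⊤) :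
    IsRelationSpace (freeProductGrading ℬ) S
      fun i => (R i).map (freeProductExtension h i).θ.toLinearMap where
  le_pow i := (Submodule.map_mono (hRle i)).trans (tensorPow_map_le _ _)
  ker_eq := ker_freeProduct_presentation h hs R hR
  minimal i := by
    rw [eq_bot_iff]
    rintro _ ⟨⟨r, hr, rfl⟩, hx⟩
    -- Minimality: the projection onto the tensor algebra of the `i`-th factor kills everything
    -- generated by relations of other factors, but is injective on those of the `i`-th. The
    -- condition `t < i` serves only to give `t ≠ i`.
    have hle : (⨆ t : S, ⨆ (_ : (t : ℕ) < i), ⨆ j ∈ Finset.range ((i : ℕ) - t + 1),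
        tensorPow k (freeProductGrading ℬ 1) j *
          (R t).map (freeProductExtension h t).θ.toLinearMap *
            tensorPow k (freeProductGrading ℬ 1) ((i : ℕ) - t - j)) ≤
        LinearMap.ker (freeProductExtension h i).ret.toLinearMap := by
      refine iSup_le fun t => iSup_le fun hti => iSup₂_le fun j _ => ?_
      refine Submodule.mul_le.2 fun x hx c _ => ?_
      have hx0 : (freeProductExtension h i).ret x = 0 := by
        induction hx using Submodule.mul_induction_on' with
        | mem_mul_mem a _ q hq =>
          obtain ⟨q, hq, rfl⟩ := hq
          have ht : (t : ℕ) ≠ 0 := by have := hS t t.2; omega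
          rw [map_mul, AlgHom.toLinearMap_apply,
            ret_θ_of_ne h (fun e => hti.ne (congrArg Subtype.val e)) ht (hRle t hq), mul_zero]
        | add x _ y _ hx hy => rw [map_add, hx, hy, add_zero]
      rw [LinearMap.mem_ker, AlgHom.toLinearMap_apply, map_mul, hx0, zero_mul]
    have h0 := hle hx
    rw [LinearMap.mem_ker, AlgHom.toLinearMap_apply, AlgHom.toLinearMap_apply,
      FreeExtension.ret_θ] at h0
    rw [h0, map_zero]
    exact zero_mem _

end Main

end

end MultiKoszul

theorem mainTheorem7 {k : Type*} [Field k] (S : Finset ℕ) (hS : ∀ s ∈ S, 2 ≤ s)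
    (B : S → Type*) [∀ s, Ring (B s)] [∀ s, Algebra k (B s)]
    (ℬ : ∀ s : S, ℕ → Submodule k (B s)) [∀ s, GradedAlgebra (ℬ s)]
    (hB : ∀ s : S, MultiKoszul.IsKoszul (s : ℕ) (ℬ s)) :
    MultiKoszul.IsMultiKoszul S (MultiKoszul.freeProductGrading ℬ) := by
  have h : ∀ s, MultiKoszul.IsConnected (ℬ s) := fun s => (hB s).connected
  have hsurj := MultiKoszul.freeProduct_presentation_surjective h fun s => (hB s).surjective
  choose R hRle hR exact_one exact_ge_two using fun s => (hB s).exists_relations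
  exact
    { two_le := hS
      connected := MultiKoszul.freeProduct_isConnected h
      finite := MultiKoszul.freeProduct_finite h fun s => (hB s).finite
      surjective := hsurj
      exists_resolution := ⟨_,
        MultiKoszul.freeProduct_isRelationSpace hS h (fun s => (hB s).surjective) R hRle hR,
        MultiKoszul.isResolution_of_freeExtensions (MultiKoszul.freeProductExtension h) hsurj
          (fun s => (hB s).surjective) (MultiKoszul.eq_zero_of_sum_eq_zero h)
          (fun x hx => MultiKoszul.exists_sum_eq_of_mem_complexOne h hx)
          (fun f hf => MultiKoszul.freeProductCombination_independent _ f
            fun s n => (h s).augmentation_eq_zero (hf s n))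
          hS R hRle exact_one exact_ge_two⟩ }
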